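/- A \emph{prop} is a strict symmetric monoidal category whose objects are the natural numbers, with tensor product of objects given by addition; a \emph{morphism of props} is a strict symmetric monoidal functor that is the identity on objects. Let $k$ be a field, and consider the following props, described by their morphisms $m \to n$. \begin{itemize} \item $\mathrm{FinCospan}$: isomorphism classes of cospans of finite sets $m \xrightarrow{i} N \xleftarrow{o} n$, composed by pushout, with disjoint union as tensor product. $\mathrm{FinCorel}$: partitions of the disjoint union $m + n$ (equivalently, isomorphism classes of jointly epic cospans), composed as cospans followed by restriction of the apex to the joint image of the legs. $H \colon \mathrm{FinCospan} \to \mathrm{FinCorel}$ is the morphism of props that restricts the apex of a cospan to the joint image of its legs. \item $\mathrm{Circ}_L$, for a set $L$: isomorphism classes of $L$-circuits, that is, cospans of finite sets $m \to N \leftarrow n$ together with a finite set $E$ of edges, source and target maps $s, t \colon E \to N$ and a labelling $\ell \colon E \to L$; composition is by pushout on nodes and disjoint union on edges, and the tensor product is disjoint union. Circuits without edges form a copy of $\mathrm{FinCospan}$, and each $l \in L$ gives a morphism $l \colon 1 \to 1$, a single edge labelled $l$ from the input node to the output node. \item $\mathrm{LagRel}_k$: linear Lagrangian relations from $(k\oplus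 k)^m$ to $(k \oplus k)^n$, that is, maximal isotropic subspaces of $\overline{(k\oplus k)^m} \oplus (k \oplus k)^n$, where $k \oplus k$ has the symplectic structure $\omega((\phi,I),(\phi',I')) = \phi I' - \phi' I$, powers carry the direct sum structure, and the bar changes the sign of the symplectic structure; composition is that of relations and the tensor product is direct sum. \item $K \colon \mathrm{FinCorel} \to \mathrm{LagRel}_k$ is the morphism of props sending a partition of $m+n$ to the set of all families of potentials and currents $(\phi_i, I_i)_{i \in m}$, $(\phi'_j, I'_j)_{j \in n}$ such that the potential is constant on each block and, on each block, the sum of the input currents $I_i$ equals the sum of the output currents $I'_j$. \end{itemize} \textbf{Theorem.} There exists a unique morphism of props $\blacksquare \colon \mathrm{Circ}_k \to \mathrm{LagRel}_k$ such that $\blacksquare|_{\mathrm{FinCospan}} = K \circ H$ and, for each $Z \in k$, \[ \blacksquare(Z) = \{ (\phi_1, I_1, \phi_2, I_2) : \phi_2 - \phi_1 = Z I_1, \; I_1 = I_2 \} \colon k \oplus k \nrightarrow k \oplus k . \] Moreover, $\blacksquare$ extends black-boxing of circuits of ideal wires: let $\mathrm{Circ} = \mathrm{Circ}_{\{\ell\}}$,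 let $H' \colon \mathrm{Circ} \to \mathrm{FinCospan}$ be the morphism of props that replaces the graph of a circuit by its set of connected components, and let $j \colon \mathrm{Circ} \to \mathrm{Circ}_k$ be the morphism of props that changes the label $\ell$ to $0 \in k$. Then $\blacksquare \circ j = K \circ H \circ H'$. -/

import Mathlib

universe u v w

namespace BlackBoxing

/-! ### Props -/

/-- Transport of a morphism `a ⟶ b` along equalities of objects. In a strict monoidal category
this is composition with the identity morphisms `a' = a` and `b = b'`. -/
def homCast {Hom : ℕ → ℕ → Type u} {a a' b b' : ℕ} (ha : a = a') (hb : b = b')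
    (f : Hom a b) : Hom a' b' :=
  ha ▸ hb ▸ f

/-- A prop: a strict symmetric monoidal category whose objects are the natural numbers, the tensor
product of objects being addition. Composition is written in diagrammatic order. The transports
`homCast` express that the associator and the unitors are identities. -/
structure PROP where
  Hom : ℕ → ℕ → Type u
  id : ∀ n, Hom n n
  comp : ∀ {a b c}, Hom a b → Hom b c → Hom a c
  tens : ∀ {a b c d}, Hom a b → Hom c d → Hom (a + c) (b + d)
  braid : ∀ a b, Hom (a + b) (b + a)
  id_comp : ∀ {a b} (f : Hom a b), comp (id a) f = f
  comp_id : ∀ {a b} (f : Hom a b), comp f (id b) = f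
  comp_assoc : ∀ {a b c d} (f : Hom a b) (g : Hom b c) (h : Hom c d),
    comp (comp f g) h = comp f (comp g h)
  tens_id : ∀ a b, tens (id a) (id b) = id (a + b)
  tens_comp : ∀ {a b c a' b' c'} (f : Hom a b) (g : Hom b c) (f' : Hom a' b') (g' : Hom b' c'),
    tens (comp f g) (comp f' g') = comp (tens f f') (tens g g')
  tens_assoc : ∀ {a b c d a' b'} (f : Hom a b) (g : Hom c d) (h : Hom a' b'),
    homCast (Nat.add_assoc a c a') (Nat.add_assoc b d b') (tens (tens f g) h)
      = tens f (tens g h)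
  id_tens : ∀ {a b} (f : Hom a b), homCast (Nat.zero_add a) (Nat.zero_add b) (tens (id 0) f) = f
  tens_id_zero : ∀ {a b} (f : Hom a b),
    homCast (Nat.add_zero a) (Nat.add_zero b) (tens f (id 0)) = f
  braid_natural : ∀ {a b c d} (f : Hom a b) (g : Hom c d),
    comp (tens f g) (braid b d) = comp (braid a c) (tens g f)
  /-- The hexagon identity; by `braid_symm` it implies the other one. -/
  hexagon : ∀ a b c,
    homCast (Nat.add_assoc a b c).symm rfl (braid a (b + c))
      = comp (tens (braid a b) (id c))
          (homCast (Nat.add_assoc b a c).symm (Nat.add_assoc b c a).symm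
            (tens (id b) (braid a c)))
  braid_symm : ∀ a b, comp (braid a b) (braid b a) = id (a + b)

/-- A morphism of props: a strict symmetric monoidal functor that is the identity on objects. -/
@[ext]
structure PROP.Mor (P : PROP.{u}) (Q : PROP.{v}) where
  map : ∀ {a b}, P.Hom a b → Q.Hom a b
  map_id : ∀ a, map (P.id a) = Q.id a
  map_comp : ∀ {a b c} (f : P.Hom a b) (g : P.Hom b c),
    map (P.comp f g) = Q.comp (map f) (map g)
  map_tens : ∀ {a b c d} (f : P.Hom a b) (g : P.Hom c d),
    map (P.tens f g) = Q.tens (map f) (map g)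
  map_braid : ∀ a b, map (P.braid a b) = Q.braid a b

/-- Composition of morphisms of props, first `F`, then `G`. -/
def PROP.Mor.trans {P : PROP.{u}} {Q : PROP.{v}} {R : PROP.{w}} (F : PROP.Mor P Q)
    (G : PROP.Mor Q R) : PROP.Mor P R where
  map f := G.map (F.map f)
  map_id a := by rw [F.map_id, G.map_id]
  map_comp f g := by rw [F.map_comp, G.map_comp]
  map_tens f g := by rw [F.map_tens, G.map_tens]
  map_braid a b := by rw [F.map_braid, G.map_braid]

/-! ### Maps between finite ordinals -/

/-- The map `a + b → A ⊔ B` that is `f` on the first `a` elements and `g` on the last `b`. -/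
def split {a b : ℕ} {A B : Type} (f : Fin a → A) (g : Fin b → B) : Fin (a + b) → A ⊕ B :=
  Fin.addCases (fun x => Sum.inl (f x)) (fun x => Sum.inr (g x))

@[simp] theorem split_castAdd {a b : ℕ} {A B : Type} (f : Fin a → A) (g : Fin b → B) (x : Fin a) :
    split f g (Fin.castAdd b x) = Sum.inl (f x) := by simp [split]

@[simp] theorem split_natAdd {a b : ℕ} {A B : Type} (f : Fin a → A) (g : Fin b → B) (x : Fin b) :
    split f g (Fin.natAdd a x) = Sum.inr (g x) := by simp [split]

theorem sum_map_split {a b : ℕ} {A B A' B' : Type} (f : Fin a → A) (g : Fin b → B) (e : A → A')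
    (e' : B → B') (x) : Sum.map e e' (split f g x) = split (fun x => e (f x)) (fun x => e' (g x)) x := by
  refine Fin.addCases (fun x => ?_) (fun x => ?_) x <;> simp

theorem sumAssoc_split {a b c : ℕ} {A B C : Type} (f : Fin a → A) (g : Fin b → B) (h : Fin c → C)
    (x : Fin (a + (b + c))) :
    Equiv.sumAssoc A B C (split (split f g) h (Fin.cast (Nat.add_assoc a b c).symm x))
      = split f (split g h) x := by
  refine Fin.addCases (fun x => ?_) (fun x => ?_) x
  · have h1 : Fin.cast (Nat.add_assoc a b c).symm (Fin.castAdd (b + c) x)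
      = Fin.castAdd c (Fin.castAdd b x) := rfl
    simp [h1]
  · refine Fin.addCases (fun x => ?_) (fun x => ?_) x
    · have h1 : Fin.cast (Nat.add_assoc a b c).symm (Fin.natAdd a (Fin.castAdd c x))
        = Fin.castAdd c (Fin.natAdd a x) := rfl
      simp [h1]
    · have h1 : Fin.cast (Nat.add_assoc a b c).symm (Fin.natAdd a (Fin.natAdd b x))
        = Fin.natAdd (a + b) x := by ext; simp [Nat.add_assoc]
      simp only [h1, split_natAdd]; simp

theorem emptySum_split {a : ℕ} {A B : Type} [IsEmpty A] (f : Fin 0 → A) (g : Fin a → B) (x : Fin a) :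
    Equiv.emptySum A B (split f g (Fin.cast (Nat.zero_add a).symm x)) = g x := by
  have h1 : Fin.cast (Nat.zero_add a).symm x = Fin.natAdd 0 x := by ext; simp
  rw [h1, split_natAdd]; rfl

theorem sumEmpty_split {a : ℕ} {A B : Type} [IsEmpty B] (f : Fin a → A) (g : Fin 0 → B) (x : Fin a) :
    Equiv.sumEmpty A B (split f g (Fin.cast (Nat.add_zero a).symm x)) = f x := by
  have h1 : Fin.cast (Nat.add_zero a).symm x = Fin.castAdd 0 x := rfl
  rw [h1, split_castAdd]; rfl

theorem sumComm_split {a b : ℕ} {A B : Type} (f : Fin a → A) (g : Fin b → B) (x) :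
    Equiv.sumComm A B (split f g x) = split g f (finAddFlip x) := by
  refine Fin.addCases (fun x => ?_) (fun x => ?_) x <;> simp

/-- Two maps of finite ordinals, side by side. -/
def finSum {a b c d : ℕ} (f : Fin a → Fin b) (g : Fin c → Fin d) : Fin (a + c) → Fin (b + d) :=
  Fin.addCases (fun x => Fin.castAdd d (f x)) (fun x => Fin.natAdd b (g x))

@[simp] theorem finSum_castAdd {a b c d : ℕ} (f : Fin a → Fin b) (g : Fin c → Fin d) (x : Fin a) :
    finSum f g (Fin.castAdd c x) = Fin.castAdd d (f x) := by simp [finSum]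

@[simp] theorem finSum_natAdd {a b c d : ℕ} (f : Fin a → Fin b) (g : Fin c → Fin d) (x : Fin c) :
    finSum f g (Fin.natAdd a x) = Fin.natAdd b (g x) := by simp [finSum]

theorem finSumFinEquiv_split {a b c d : ℕ} (f : Fin a → Fin b) (g : Fin c → Fin d) (x) :
    finSumFinEquiv (split f g x) = finSum f g x := by
  refine Fin.addCases (fun x => ?_) (fun x => ?_) x <;> simp

theorem finSum_id (a b : ℕ) : finSum (id : Fin a → Fin a) (id : Fin b → Fin b) = id := by
  funext x
  refine Fin.addCases (fun x => ?_) (fun x => ?_) x <;> simp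

theorem flip_flip (a b : ℕ) :
    (finAddFlip : Fin (b + a) ≃ Fin (a + b)) ∘ (finAddFlip : Fin (a + b) ≃ Fin (b + a)) = id := by
  funext x
  refine Fin.addCases (fun x => ?_) (fun x => ?_) x <;> simp

theorem flip_hexagon (a b c : ℕ) :
    (finAddFlip : Fin (a + (b + c)) ≃ Fin (b + c + a)) ∘ Fin.cast (Nat.add_assoc a b c)
      = (Fin.cast (Nat.add_assoc b c a).symm ∘
          finSum (id : Fin b → Fin b) (finAddFlip : Fin (a + c) ≃ Fin (c + a)) ∘
          Fin.cast (Nat.add_assoc b a c)) ∘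
        finSum (finAddFlip : Fin (a + b) ≃ Fin (b + a)) (id : Fin c → Fin c) := by
  funext x
  refine Fin.addCases (fun x => ?_) (fun x => ?_) x
  · refine Fin.addCases (fun x => ?_) (fun x => ?_) x
    · have h1 : Fin.cast (Nat.add_assoc a b c) (Fin.castAdd c (Fin.castAdd b x))
          = Fin.castAdd (b + c) x := rfl
      have h2 : Fin.cast (Nat.add_assoc b a c) (Fin.castAdd c (Fin.natAdd b x))
          = Fin.natAdd b (Fin.castAdd c x) := rfl
      simp only [Function.comp_apply, h1, finSum_castAdd, finAddFlip_apply_castAdd, h2,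
        finSum_natAdd]
      ext; simp [Nat.add_assoc]
    · have h1 : Fin.cast (Nat.add_assoc a b c) (Fin.castAdd c (Fin.natAdd a x))
          = Fin.natAdd a (Fin.castAdd c x) := rfl
      have h2 : Fin.cast (Nat.add_assoc b a c) (Fin.castAdd c (Fin.castAdd a x))
          = Fin.castAdd (a + c) x := rfl
      simp only [Function.comp_apply, h1, finSum_castAdd, finAddFlip_apply_natAdd, h2, id]
      ext; simp
  · have h1 : Fin.cast (Nat.add_assoc a b c) (Fin.natAdd (a + b) x)
        = Fin.natAdd a (Fin.natAdd b x) := by ext; simp [Nat.add_assoc]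
    have h2 : Fin.cast (Nat.add_assoc b a c) (Fin.natAdd (b + a) x)
        = Fin.natAdd b (Fin.natAdd a x) := by ext; simp [Nat.add_assoc]
    simp only [Function.comp_apply, h1, finSum_natAdd, finAddFlip_apply_natAdd, h2, id]
    ext; simp

/-! ### Pushouts of finite sets -/

/-- The pushout `A +_Y B` of `f : Y → A` and `g : Y → B`. -/
def Pushout {Y A B : Type} (f : Y → A) (g : Y → B) : Type :=
  Quot (fun p q : A ⊕ B => ∃ y, p = Sum.inl (f y) ∧ q = Sum.inr (g y))

namespace Pushout

variable {Y A B : Type} {f : Y → A} {g : Y → B}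

/-- The first coprojection into the pushout. -/
def inl (f : Y → A) (g : Y → B) (x : A) : Pushout f g := Quot.mk _ (Sum.inl x)

/-- The second coprojection into the pushout. -/
def inr (f : Y → A) (g : Y → B) (x : B) : Pushout f g := Quot.mk _ (Sum.inr x)

theorem glue (y : Y) : inl f g (f y) = inr f g (g y) := Quot.sound ⟨y, rfl, rfl⟩

/-- The universal property of the pushout. -/
def desc {W : Type*} (h : A → W) (h' : B → W) (H : ∀ y, h (f y) = h' (g y)) : Pushout f g → W :=
  Quot.lift (Sum.elim h h') (by rintro _ _ ⟨y, rfl, rfl⟩; exact H y)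

theorem ind {P : Pushout f g → Prop} (h : ∀ x, P (inl f g x)) (h' : ∀ x, P (inr f g x)) (p) :
    P p := by
  rcases p with ⟨x | x⟩
  exacts [h x, h' x]

instance [Finite A] [Finite B] : Finite (Pushout f g) :=
  inferInstanceAs (Finite (Quot _))

/-- Isomorphic diagrams have isomorphic pushouts. -/
def congr {A' B' : Type} {f' : Y → A'} {g' : Y → B'} (e : A ≃ A') (e' : B ≃ B')
    (h : ∀ y, e (f y) = f' y) (h' : ∀ y, e' (g y) = g' y) : Pushout f g ≃ Pushout f' g' where
  toFun := desc (fun x => inl _ _ (e x)) (fun x => inr _ _ (e' x))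
    (fun y => by rw [h, h', glue])
  invFun := desc (fun x => inl _ _ (e.symm x)) (fun x => inr _ _ (e'.symm x))
    (fun y => by rw [← h, ← h', e.symm_apply_apply, e'.symm_apply_apply, glue])
  left_inv := by
    refine ind (fun x => ?_) (fun x => ?_)
    · exact congrArg (inl f g) (e.symm_apply_apply x)
    · exact congrArg (inr f g) (e'.symm_apply_apply x)
  right_inv := by
    refine ind (fun x => ?_) (fun x => ?_)
    · exact congrArg (inl f' g') (e.apply_symm_apply x)
    · exact congrArg (inr f' g') (e'.apply_symm_apply x)

/-- Pushout along an identity. -/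
def idLeft (g : Y → B) : Pushout (id : Y → Y) g ≃ B where
  toFun := desc g id (fun _ => rfl)
  invFun := inr _ _
  left_inv := ind (fun x => (glue (f := (id : Y → Y)) x).symm) (fun _ => rfl)
  right_inv _ := rfl

/-- Pushout along a bijection. -/
def equivRight (f : Y → A) (e : Y ≃ B) : Pushout f e ≃ A where
  toFun := desc id (fun b => f (e.symm b)) (fun y => by simp)
  invFun := inl _ _
  left_inv := ind (fun _ => rfl) (fun x => by
    have := glue (f := f) (g := e) (e.symm x)
    rw [e.apply_symm_apply] at this
    exact this)
  right_inv _ := rfl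

/-- Iterated pushouts are associative. -/
def assoc {Z C : Type} (f : Y → A) (g : Y → B) (f' : Z → B) (g' : Z → C) :
    Pushout (fun z => inr f g (f' z)) g' ≃ Pushout f (fun y => inl f' g' (g y)) where
  toFun := desc
    (desc (fun x => inl _ _ x) (fun x => inr _ _ (inl _ _ x)) (fun y => glue y))
    (fun x => inr _ _ (inr _ _ x))
    (fun z => congrArg (inr _ _) (glue (f := f') (g := g') z))
  invFun := desc
    (fun x => inl _ _ (inl _ _ x))
    (desc (fun x => inl _ _ (inr _ _ x)) (fun x => inr _ _ x) (fun z => glue z))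
    (fun y => congrArg (inl _ _) (glue (f := f) (g := g) y))
  left_inv := ind (ind (fun _ => rfl) (fun _ => rfl)) (fun _ => rfl)
  right_inv := ind (fun _ => rfl) (ind (fun _ => rfl) (fun _ => rfl))

/-- The pushout of a disjoint union of diagrams. -/
def sum {b b' : ℕ} {A B A' B' : Type} (f : Fin b → A) (g : Fin b → B) (f' : Fin b' → A')
    (g' : Fin b' → B') :
    Pushout f g ⊕ Pushout f' g' ≃ Pushout (split f f') (split g g') where
  toFun := Sum.elim
    (desc (fun x => inl _ _ (Sum.inl x)) (fun x => inr _ _ (Sum.inl x)) (fun y => by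
      simpa using glue (f := split f f') (g := split g g') (Fin.castAdd b' y)))
    (desc (fun x => inl _ _ (Sum.inr x)) (fun x => inr _ _ (Sum.inr x)) (fun y => by
      simpa using glue (f := split f f') (g := split g g') (Fin.natAdd b y)))
  invFun := desc (Sum.map (inl _ _) (inl _ _)) (Sum.map (inr _ _) (inr _ _)) (fun y => by
    refine Fin.addCases (fun x => ?_) (fun x => ?_) y <;> simp [glue])
  left_inv := by
    rintro (x | x)
    · revert x; exact ind (fun _ => rfl) (fun _ => rfl)
    · revert x; exact ind (fun _ => rfl) (fun _ => rfl)
  right_inv := by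
    refine ind ?_ ?_ <;> rintro (x | x) <;> rfl

/-- A map of diagrams that is injective on the two vertices and the identity on `Y` induces an
injective map of pushouts. -/
theorem map_injective {A' B' : Type} {f' : Y → A'} {g' : Y → B'} (j : A → A') (j' : B → B')
    (hj : Function.Injective j) (hj' : Function.Injective j')
    (h : ∀ y, j (f y) = f' y) (h' : ∀ y, j' (g y) = g' y) :
    Function.Injective (desc (f := f) (g := g) (fun x => inl f' g' (j x))
      (fun x => inr f' g' (j' x)) (fun y => by rw [h, h', glue])) := by
  classical
  let r : Pushout f' g' → Option (Pushout f g) := desc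
    (fun x => (Function.partialInv j x).map (inl f g))
    (fun x => (Function.partialInv j' x).map (inr f g))
    (fun y => by
      rw [← h, ← h', Function.partialInv_left hj, Function.partialInv_left hj']
      simp [glue])
  have hr : ∀ p, r (desc (f := f) (g := g) (fun x => inl f' g' (j x))
      (fun x => inr f' g' (j' x)) (fun y => by rw [h, h', glue]) p) = some p := by
    refine ind (fun x => ?_) (fun x => ?_)
    · change (Function.partialInv j (j x)).map (inl f g) = _
      rw [Function.partialInv_left hj]; rfl
    · change (Function.partialInv j' (j' x)).map (inr f g) = _
      rw [Function.partialInv_left hj']; rfl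
  intro p q hpq
  have := congrArg r hpq
  rw [hr, hr] at this
  exact Option.some.inj this

end Pushout

/-! ### The prop of cospans of finite sets -/

/-- A cospan of finite sets `m → N ← n`. -/
structure Cospan (m n : ℕ) where
  N : Type
  [fin : Finite N]
  i : Fin m → N
  o : Fin n → N

attribute [instance] Cospan.fin

namespace Cospan

/-- Isomorphism of cospans. -/
instance isoSetoid (m n : ℕ) : Setoid (Cospan m n) where
  r f g := ∃ e : f.N ≃ g.N, (∀ x, e (f.i x) = g.i x) ∧ ∀ y, e (f.o y) = g.o y
  iseqv :=
    { refl := fun f => ⟨Equiv.refl _, fun _ => rfl, fun _ => rfl⟩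
      symm := by
        rintro f g ⟨e, h, h'⟩
        exact ⟨e.symm, fun x => by rw [← h, e.symm_apply_apply],
          fun x => by rw [← h', e.symm_apply_apply]⟩
      trans := by
        rintro f g k ⟨e, h, h'⟩ ⟨e₂, h₂, h₂'⟩
        exact ⟨e.trans e₂, fun x => by simp [h, h₂], fun x => by simp [h', h₂']⟩ }

/-- Composition of cospans by pushout. -/
def comp {a b c : ℕ} (f : Cospan a b) (g : Cospan b c) : Cospan a c where
  N := Pushout f.o g.i
  i x := Pushout.inl _ _ (f.i x)
  o z := Pushout.inr _ _ (g.o z)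

/-- Disjoint union of cospans. -/
def tens {a b c d : ℕ} (f : Cospan a b) (g : Cospan c d) : Cospan (a + c) (b + d) where
  N := f.N ⊕ g.N
  i := split f.i g.i
  o := split f.o g.o

/-- The cospan `m → n ← n` given by a function and an identity. -/
def ofFun {m n : ℕ} (φ : Fin m → Fin n) : Cospan m n where
  N := Fin n
  i := φ
  o := id

theorem comp_congr {a b c : ℕ} {f f' : Cospan a b} {g g' : Cospan b c} (hf : f ≈ f')
    (hg : g ≈ g') : f.comp g ≈ f'.comp g' := by
  obtain ⟨e, h, h'⟩ := hf
  obtain ⟨e₂, h₂, h₂'⟩ := hg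
  exact ⟨Pushout.congr e e₂ h' h₂, fun x => congrArg (Pushout.inl _ _) (h x),
    fun x => congrArg (Pushout.inr _ _) (h₂' x)⟩

theorem tens_congr {a b c d : ℕ} {f f' : Cospan a b} {g g' : Cospan c d} (hf : f ≈ f')
    (hg : g ≈ g') : f.tens g ≈ f'.tens g' := by
  obtain ⟨e, h, h'⟩ := hf
  obtain ⟨e₂, h₂, h₂'⟩ := hg
  exact ⟨Equiv.sumCongr e e₂,
    fun x => (sum_map_split _ _ _ _ x).trans (by simp only [h, h₂]; rfl),
    fun x => (sum_map_split _ _ _ _ x).trans (by simp only [h', h₂']; rfl)⟩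

/-- Transport of a cospan along equalities of objects. -/
def reindex {a a' b b' : ℕ} (ha : a = a') (hb : b = b') (f : Cospan a b) : Cospan a' b' where
  N := f.N
  i x := f.i (Fin.cast ha.symm x)
  o x := f.o (Fin.cast hb.symm x)

end Cospan

/-- Morphisms `m ⟶ n` of `FinCospan`: isomorphism classes of cospans of finite sets. -/
def CospanHom (m n : ℕ) : Type 1 := Quotient (Cospan.isoSetoid m n)

namespace CospanHom

def mk {m n : ℕ} (f : Cospan m n) : CospanHom m n := Quotient.mk _ f

theorem ind {m n : ℕ} {P : CospanHom m n → Prop} (h : ∀ f, P (mk f)) (f) : P f :=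
  Quotient.ind h f

def id (n : ℕ) : CospanHom n n := mk (Cospan.ofFun _root_.id)

def comp {a b c : ℕ} : CospanHom a b → CospanHom b c → CospanHom a c :=
  Quotient.map₂ Cospan.comp (fun _ _ h _ _ h' => Cospan.comp_congr h h')

def tens {a b c d : ℕ} : CospanHom a b → CospanHom c d → CospanHom (a + c) (b + d) :=
  Quotient.map₂ Cospan.tens (fun _ _ h _ _ h' => Cospan.tens_congr h h')

def ofFun {m n : ℕ} (φ : Fin m → Fin n) : CospanHom m n := mk (Cospan.ofFun φ)

theorem mk_eq {m n : ℕ} {f g : Cospan m n} (e : f.N ≃ g.N) (h : ∀ x, e (f.i x) = g.i x)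
    (h' : ∀ x, e (f.o x) = g.o x) : mk f = mk g := Quotient.sound ⟨e, h, h'⟩

theorem comp_mk {a b c : ℕ} (f : Cospan a b) (g : Cospan b c) :
    comp (mk f) (mk g) = mk (f.comp g) := rfl

theorem tens_mk {a b c d : ℕ} (f : Cospan a b) (g : Cospan c d) :
    tens (mk f) (mk g) = mk (f.tens g) := rfl

theorem homCast_mk {a a' b b' : ℕ} (ha : a = a') (hb : b = b') (f : Cospan a b) :
    homCast ha hb (mk f) = mk (f.reindex ha hb) := by
  subst ha hb; rfl

theorem ofFun_comp {a b c : ℕ} (φ : Fin a → Fin b) (g : Cospan b c) :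
    comp (ofFun φ) (mk g) = mk { g with i := fun x => g.i (φ x) } :=
  mk_eq (Pushout.idLeft g.i) (fun _ => rfl) (fun _ => rfl)

theorem comp_ofFun {a b c : ℕ} (f : Cospan a b) (e : Fin b ≃ Fin c) :
    comp (mk f) (ofFun e) = mk { f with o := fun x => f.o (e.symm x) } :=
  mk_eq (Pushout.equivRight f.o e) (fun _ => rfl) (fun _ => rfl)

theorem ofFun_comp_ofFun {a b c : ℕ} (φ : Fin a → Fin b) (ψ : Fin b → Fin c) :
    comp (ofFun φ) (ofFun ψ) = ofFun (ψ ∘ φ) := ofFun_comp φ _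

theorem ofFun_tens_ofFun {a b c d : ℕ} (φ : Fin a → Fin b) (ψ : Fin c → Fin d) :
    tens (ofFun φ) (ofFun ψ) = ofFun (finSum φ ψ) := by
  refine mk_eq finSumFinEquiv (fun x => finSumFinEquiv_split _ _ x) (fun x => ?_)
  exact (finSumFinEquiv_split _ _ x).trans (congrFun (finSum_id b d) x)

theorem homCast_ofFun {a a' b b' : ℕ} (ha : a = a') (hb : b = b') (φ : Fin a → Fin b) :
    homCast ha hb (ofFun φ) = ofFun (Fin.cast hb ∘ φ ∘ Fin.cast ha.symm) := by
  subst ha hb; rfl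

end CospanHom

open CospanHom in
/-- The prop of cospans of finite sets. -/
def FinCospan : PROP.{1} where
  Hom := CospanHom
  id := CospanHom.id
  comp := comp
  tens := tens
  braid a b := ofFun finAddFlip
  id_comp f := by
    induction f using CospanHom.ind with | _ f => exact ofFun_comp _ f
  comp_id f := by
    induction f using CospanHom.ind with | _ f => exact comp_ofFun f (Equiv.refl _)
  comp_assoc f g h := by
    induction f using CospanHom.ind with | _ f =>
    induction g using CospanHom.ind with | _ g =>
    induction h using CospanHom.ind with | _ h =>
    exact mk_eq (Pushout.assoc f.o g.i g.o h.i) (fun _ => rfl) (fun _ => rfl)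
  tens_id a b := by
    simp only [CospanHom.id]
    exact (ofFun_tens_ofFun _ _).trans (by rw [finSum_id]; rfl)
  tens_comp f g f' g' := by
    induction f using CospanHom.ind with | _ f =>
    induction g using CospanHom.ind with | _ g =>
    induction f' using CospanHom.ind with | _ f' =>
    induction g' using CospanHom.ind with | _ g' =>
    refine mk_eq (Pushout.sum f.o g.i f'.o g'.i) (fun x => ?_) (fun x => ?_) <;>
      refine Fin.addCases (fun x => ?_) (fun x => ?_) x <;>
      simp [Cospan.tens, Cospan.comp] <;> rfl
  tens_assoc {a b c d a' b'} f g h := by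
    induction f using CospanHom.ind with | _ f =>
    induction g using CospanHom.ind with | _ g =>
    induction h using CospanHom.ind with | _ h =>
    simp only [tens_mk, homCast_mk]
    exact mk_eq (Equiv.sumAssoc _ _ _) (fun x => sumAssoc_split _ _ _ x)
      (fun x => sumAssoc_split _ _ _ x)
  id_tens {a b} f := by
    induction f using CospanHom.ind with | _ f =>
    simp only [CospanHom.id, tens_mk, homCast_mk]
    exact mk_eq (Equiv.emptySum (Fin 0) f.N) (fun x => emptySum_split (_root_.id : Fin 0 → Fin 0) _ x)
      (fun x => emptySum_split (_root_.id : Fin 0 → Fin 0) _ x)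
  tens_id_zero {a b} f := by
    induction f using CospanHom.ind with | _ f =>
    simp only [CospanHom.id, tens_mk, homCast_mk]
    exact mk_eq (Equiv.sumEmpty f.N (Fin 0)) (fun x => sumEmpty_split _ (_root_.id : Fin 0 → Fin 0) x)
      (fun x => sumEmpty_split _ (_root_.id : Fin 0 → Fin 0) x)
  braid_natural f g := by
    induction f using CospanHom.ind with | _ f =>
    induction g using CospanHom.ind with | _ g =>
    rw [tens_mk, tens_mk, comp_ofFun, ofFun_comp]
    refine mk_eq (Equiv.sumComm _ _) (fun x => sumComm_split _ _ x) (fun x => ?_)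
    refine (sumComm_split _ _ _).trans ?_
    exact congrArg (split g.o f.o) (congrFun (flip_flip _ _) x)
  hexagon a b c := by
    simp only [CospanHom.id]
    rw [homCast_ofFun]
    change _ = comp (tens (ofFun _) (ofFun _)) (homCast _ _ (tens (ofFun _) (ofFun _)))
    rw [ofFun_tens_ofFun, ofFun_tens_ofFun, homCast_ofFun, ofFun_comp_ofFun, ← flip_hexagon]
    rfl
  braid_symm a b := by
    rw [ofFun_comp_ofFun, flip_flip]; rfl

/-! ### The prop of corelations -/

/-- A corelation from `m` to `n`: an equivalence relation on (that is, a partition of) the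
disjoint union `m ⊔ n`. -/
def Corel (m n : ℕ) : Type := Setoid (Fin m ⊕ Fin n)

/-- `R.Rel s t` means that `s` and `t` lie in the same block of the corelation `R`. -/
def Corel.Rel {m n : ℕ} (R : Corel m n) (s t : Fin m ⊕ Fin n) : Prop := Setoid.r (self := R) s t

/-- The corelation given by the jointly epic part of a cospan: two elements of `m ⊔ n` are
equivalent when they have the same image in the apex. -/
def Cospan.toCorel {m n : ℕ} (f : Cospan m n) : Corel m n := Setoid.ker (Sum.elim f.i f.o)

/-- A corelation, seen as a jointly epic cospan with the set of blocks as apex. -/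
def Corel.toCospan {m n : ℕ} (R : Corel m n) : Cospan m n where
  N := Quotient R
  fin := Finite.of_surjective (Quotient.mk R) Quotient.exists_rep
  i x := Quotient.mk R (Sum.inl x)
  o y := Quotient.mk R (Sum.inr y)

namespace Corel

theorem toCorel_toCospan {m n : ℕ} (R : Corel m n) : R.toCospan.toCorel = R := by
  have h : Sum.elim R.toCospan.i R.toCospan.o = Quotient.mk R := by
    funext x; rcases x with x | x <;> rfl
  unfold Cospan.toCorel
  rw [h]
  exact Setoid.ker_mk_eq R

theorem toCorel_eq_of_injective {m n : ℕ} {f g : Cospan m n} (j : f.N → g.N)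
    (hj : Function.Injective j) (h : ∀ x, j (f.i x) = g.i x) (h' : ∀ y, j (f.o y) = g.o y) :
    f.toCorel = g.toCorel := by
  have : Sum.elim g.i g.o = j ∘ Sum.elim f.i f.o := by
    funext x; rcases x with x | x <;> simp [h, h']
  refine Setoid.ext fun x y => ?_
  change Sum.elim f.i f.o x = Sum.elim f.i f.o y ↔ Sum.elim g.i g.o x = Sum.elim g.i g.o y
  rw [this]
  exact hj.eq_iff.symm

/-- The inclusion of the joint image of a cospan into its apex. -/
def incl {m n : ℕ} (f : Cospan m n) : f.toCorel.toCospan.N → f.N :=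
  Setoid.kerLift (Sum.elim f.i f.o)

theorem incl_injective {m n : ℕ} (f : Cospan m n) : Function.Injective (incl f) :=
  Setoid.kerLift_injective _

theorem toCorel_comp {a b c : ℕ} (f : Cospan a b) (g : Cospan b c) :
    (f.toCorel.toCospan.comp g.toCorel.toCospan).toCorel = (f.comp g).toCorel :=
  toCorel_eq_of_injective _
    (Pushout.map_injective (incl f) (incl g) (incl_injective f) (incl_injective g)
      (fun _ => rfl) (fun _ => rfl)) (fun _ => rfl) (fun _ => rfl)

theorem toCorel_tens {a b c d : ℕ} (f : Cospan a b) (g : Cospan c d) :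
    (f.toCorel.toCospan.tens g.toCorel.toCospan).toCorel = (f.tens g).toCorel :=
  toCorel_eq_of_injective (Sum.map (incl f) (incl g))
    (Sum.map_injective.2 ⟨incl_injective f, incl_injective g⟩)
    (fun x => sum_map_split _ _ _ _ x) (fun x => sum_map_split _ _ _ _ x)

/-- The identity corelation. -/
def id (n : ℕ) : Corel n n := (Cospan.ofFun _root_.id).toCorel

/-- Composition of corelations: compose as cospans, then restrict to the joint image. -/
def comp {a b c : ℕ} (R : Corel a b) (S : Corel b c) : Corel a c :=
  (R.toCospan.comp S.toCospan).toCorel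

/-- Disjoint union of corelations. -/
def tens {a b c d : ℕ} (R : Corel a b) (S : Corel c d) : Corel (a + c) (b + d) :=
  (R.toCospan.tens S.toCospan).toCorel

/-- The corelation of a morphism of `FinCospan`. -/
def ofCospanHom {m n : ℕ} : CospanHom m n → Corel m n :=
  Quotient.lift Cospan.toCorel (by
    rintro f g ⟨e, h, h'⟩
    exact toCorel_eq_of_injective e e.injective h h')

theorem ofCospanHom_surjective {m n : ℕ} (R : Corel m n) : ∃ f, ofCospanHom f = R :=
  ⟨CospanHom.mk R.toCospan, R.toCorel_toCospan⟩

theorem ofCospanHom_comp {a b c : ℕ} (f : CospanHom a b) (g : CospanHom b c) :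
    ofCospanHom (CospanHom.comp f g) = comp (ofCospanHom f) (ofCospanHom g) := by
  induction f using CospanHom.ind with | _ f =>
  induction g using CospanHom.ind with | _ g =>
  exact (toCorel_comp f g).symm

theorem ofCospanHom_tens {a b c d : ℕ} (f : CospanHom a b) (g : CospanHom c d) :
    ofCospanHom (CospanHom.tens f g) = tens (ofCospanHom f) (ofCospanHom g) := by
  induction f using CospanHom.ind with | _ f =>
  induction g using CospanHom.ind with | _ g =>
  exact (toCorel_tens f g).symm

theorem ofCospanHom_homCast {a a' b b' : ℕ} (ha : a = a') (hb : b = b') (f : CospanHom a b) :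
    ofCospanHom (homCast ha hb f) = homCast ha hb (ofCospanHom f) := by
  subst ha hb; rfl

end Corel

open Corel in
/-- The prop of corelations. -/
def FinCorel : PROP.{0} where
  Hom := Corel
  id := Corel.id
  comp := comp
  tens := tens
  braid a b := (Cospan.ofFun finAddFlip).toCorel
  id_comp f := by
    obtain ⟨f, rfl⟩ := ofCospanHom_surjective f
    exact (ofCospanHom_comp (CospanHom.id _) f).symm.trans
      (congrArg ofCospanHom (FinCospan.id_comp f))
  comp_id f := by
    obtain ⟨f, rfl⟩ := ofCospanHom_surjective f
    exact (ofCospanHom_comp f (CospanHom.id _)).symm.trans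
      (congrArg ofCospanHom (FinCospan.comp_id f))
  comp_assoc f g h := by
    obtain ⟨f, rfl⟩ := ofCospanHom_surjective f
    obtain ⟨g, rfl⟩ := ofCospanHom_surjective g
    obtain ⟨h, rfl⟩ := ofCospanHom_surjective h
    simp only [← ofCospanHom_comp]
    exact congrArg ofCospanHom (FinCospan.comp_assoc f g h)
  tens_id a b := (ofCospanHom_tens (CospanHom.id a) (CospanHom.id b)).symm.trans
    (congrArg ofCospanHom (FinCospan.tens_id a b))
  tens_comp f g f' g' := by
    obtain ⟨f, rfl⟩ := ofCospanHom_surjective f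
    obtain ⟨g, rfl⟩ := ofCospanHom_surjective g
    obtain ⟨f', rfl⟩ := ofCospanHom_surjective f'
    obtain ⟨g', rfl⟩ := ofCospanHom_surjective g'
    simp only [← ofCospanHom_comp, ← ofCospanHom_tens]
    exact congrArg ofCospanHom (FinCospan.tens_comp f g f' g')
  tens_assoc f g h := by
    obtain ⟨f, rfl⟩ := ofCospanHom_surjective f
    obtain ⟨g, rfl⟩ := ofCospanHom_surjective g
    obtain ⟨h, rfl⟩ := ofCospanHom_surjective h
    simp only [← ofCospanHom_homCast, ← ofCospanHom_tens]
    exact congrArg ofCospanHom (FinCospan.tens_assoc f g h)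
  id_tens f := by
    obtain ⟨f, rfl⟩ := ofCospanHom_surjective f
    change homCast _ _ (tens (ofCospanHom (CospanHom.id 0)) _) = _
    simp only [← ofCospanHom_homCast, ← ofCospanHom_tens]
    exact congrArg ofCospanHom (FinCospan.id_tens f)
  tens_id_zero f := by
    obtain ⟨f, rfl⟩ := ofCospanHom_surjective f
    change homCast _ _ (tens _ (ofCospanHom (CospanHom.id 0))) = _
    simp only [← ofCospanHom_homCast, ← ofCospanHom_tens]
    exact congrArg ofCospanHom (FinCospan.tens_id_zero f)
  braid_natural {a b c d} f g := by
    obtain ⟨f, rfl⟩ := ofCospanHom_surjective f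
    obtain ⟨g, rfl⟩ := ofCospanHom_surjective g
    change comp _ (ofCospanHom (FinCospan.braid b d)) = comp (ofCospanHom (FinCospan.braid a c)) _
    simp only [← ofCospanHom_tens]
    exact ((ofCospanHom_comp _ _).symm.trans
      (congrArg ofCospanHom (FinCospan.braid_natural f g))).trans
        (ofCospanHom_comp (FinCospan.braid a c) (FinCospan.tens g f))
  hexagon a b c := by
    have h := congrArg ofCospanHom (FinCospan.hexagon a b c)
    refine Eq.trans ?_ (h.trans ?_)
    · exact (ofCospanHom_homCast _ _ (FinCospan.braid a (b + c))).symm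
    · refine (ofCospanHom_comp (FinCospan.tens (FinCospan.braid a b) (FinCospan.id c))
        (homCast _ _ (FinCospan.tens (FinCospan.id b) (FinCospan.braid a c)))).trans ?_
      congr 1
      · exact ofCospanHom_tens (FinCospan.braid a b) (FinCospan.id c)
      · exact (ofCospanHom_homCast _ _ _).trans
          (congrArg _ (ofCospanHom_tens (FinCospan.id b) (FinCospan.braid a c)))
  braid_symm a b := (ofCospanHom_comp (FinCospan.braid a b) (FinCospan.braid b a)).symm.trans
    (congrArg ofCospanHom (FinCospan.braid_symm a b))

/-- The morphism of props `H` that restricts the apex of a cospan to the joint image of its legs. -/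
def H : PROP.Mor FinCospan FinCorel where
  map := Corel.ofCospanHom
  map_id _ := rfl
  map_comp := Corel.ofCospanHom_comp
  map_tens := Corel.ofCospanHom_tens
  map_braid _ _ := rfl

/-! ### The props of circuits -/

/-- An `L`-circuit from `m` to `n`: a cospan of finite sets `i : m → N ← n : o` together with a
finite set `E` of edges, source and target maps `s t : E → N` and a labelling `ℓ : E → L`. -/
structure LCircuit (L : Type u) (m n : ℕ) extends Cospan m n where
  E : Type
  [finE : Finite E]
  s : E → N
  t : E → N
  ℓ : E → L

attribute [instance] LCircuit.finE

namespace LCircuit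

variable {L : Type u}

/-- Isomorphism of `L`-circuits. -/
instance isoSetoid (L : Type u) (m n : ℕ) : Setoid (LCircuit L m n) where
  r f g := ∃ (e : f.N ≃ g.N) (e' : f.E ≃ g.E), (∀ x, e (f.i x) = g.i x) ∧
    (∀ y, e (f.o y) = g.o y) ∧ (∀ a, e (f.s a) = g.s (e' a)) ∧ (∀ a, e (f.t a) = g.t (e' a)) ∧
    ∀ a, f.ℓ a = g.ℓ (e' a)
  iseqv :=
    { refl := fun f => ⟨Equiv.refl _, Equiv.refl _, fun _ => rfl, fun _ => rfl, fun _ => rfl,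
        fun _ => rfl, fun _ => rfl⟩
      symm := by
        rintro f g ⟨e, e', h₁, h₂, h₃, h₄, h₅⟩
        refine ⟨e.symm, e'.symm, fun x => ?_, fun x => ?_, fun x => ?_, fun x => ?_, fun x => ?_⟩
        · rw [← h₁, e.symm_apply_apply]
        · rw [← h₂, e.symm_apply_apply]
        · rw [e.symm_apply_eq, h₃, e'.apply_symm_apply]
        · rw [e.symm_apply_eq, h₄, e'.apply_symm_apply]
        · rw [h₅, e'.apply_symm_apply]
      trans := by
        rintro f g k ⟨e, e', h₁, h₂, h₃, h₄, h₅⟩ ⟨d, d', k₁, k₂, k₃, k₄, k₅⟩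
        exact ⟨e.trans d, e'.trans d', fun x => by simp [h₁, k₁], fun x => by simp [h₂, k₂],
          fun x => by simp [h₃, k₃], fun x => by simp [h₄, k₄], fun x => by simp [h₅, k₅]⟩ }

/-- Composition of `L`-circuits: pushout on nodes, disjoint union on edges. -/
def comp {a b c : ℕ} (f : LCircuit L a b) (g : LCircuit L b c) : LCircuit L a c where
  toCospan := f.toCospan.comp g.toCospan
  E := f.E ⊕ g.E
  s := Sum.elim (fun x => Pushout.inl _ _ (f.s x)) (fun x => Pushout.inr _ _ (g.s x))
  t := Sum.elim (fun x => Pushout.inl _ _ (f.t x)) (fun x => Pushout.inr _ _ (g.t x))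
  ℓ := Sum.elim f.ℓ g.ℓ

/-- Disjoint union of `L`-circuits. -/
def tens {a b c d : ℕ} (f : LCircuit L a b) (g : LCircuit L c d) :
    LCircuit L (a + c) (b + d) where
  toCospan := f.toCospan.tens g.toCospan
  E := f.E ⊕ g.E
  s := Sum.map f.s g.s
  t := Sum.map f.t g.t
  ℓ := Sum.elim f.ℓ g.ℓ

/-- A cospan, seen as an `L`-circuit without edges. -/
def ofCospan {m n : ℕ} (f : Cospan m n) : LCircuit L m n where
  toCospan := f
  E := Empty
  s := Empty.elim
  t := Empty.elim
  ℓ := Empty.elim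

/-- The `L`-circuit with one input, one output and a single edge, labelled `l`, from the input
node to the output node. -/
def edge (l : L) : LCircuit L 1 1 where
  N := Fin 2
  i _ := 0
  o _ := 1
  E := Unit
  s _ := 0
  t _ := 1
  ℓ _ := l

/-- Change of labels along a function. -/
def relabel {L' : Type v} (p : L → L') {m n : ℕ} (f : LCircuit L m n) : LCircuit L' m n where
  toCospan := f.toCospan
  E := f.E
  s := f.s
  t := f.t
  ℓ e := p (f.ℓ e)

/-- The set of connected components of the underlying graph. -/
def Components {m n : ℕ} (f : LCircuit L m n) : Type :=
  Quot (fun p q : f.N => ∃ e, p = f.s e ∧ q = f.t e)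

/-- The underlying cospan of connected components. -/
def components {m n : ℕ} (f : LCircuit L m n) : Cospan m n where
  N := f.Components
  fin := inferInstanceAs (Finite (Quot _))
  i x := Quot.mk _ (f.i x)
  o y := Quot.mk _ (f.o y)

/-- Transport of a circuit along equalities of objects. -/
def reindex {a a' b b' : ℕ} (ha : a = a') (hb : b = b') (f : LCircuit L a b) :
    LCircuit L a' b' where
  toCospan := f.toCospan.reindex ha hb
  E := f.E
  s := f.s
  t := f.t
  ℓ := f.ℓ

theorem comp_congr {a b c : ℕ} {f f' : LCircuit L a b} {g g' : LCircuit L b c} (hf : f ≈ f')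
    (hg : g ≈ g') : f.comp g ≈ f'.comp g' := by
  obtain ⟨e, e', h₁, h₂, h₃, h₄, h₅⟩ := hf
  obtain ⟨d, d', k₁, k₂, k₃, k₄, k₅⟩ := hg
  refine ⟨Pushout.congr e d h₂ k₁, Equiv.sumCongr e' d',
    fun x => congrArg (Pushout.inl _ _) (h₁ x), fun x => congrArg (Pushout.inr _ _) (k₂ x),
    ?_, ?_, ?_⟩ <;> rintro (x | x)
  · exact congrArg (Pushout.inl _ _) (h₃ x)
  · exact congrArg (Pushout.inr _ _) (k₃ x)
  · exact congrArg (Pushout.inl _ _) (h₄ x)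
  · exact congrArg (Pushout.inr _ _) (k₄ x)
  · exact h₅ x
  · exact k₅ x

theorem tens_congr {a b c d : ℕ} {f f' : LCircuit L a b} {g g' : LCircuit L c d} (hf : f ≈ f')
    (hg : g ≈ g') : f.tens g ≈ f'.tens g' := by
  obtain ⟨e, e', h₁, h₂, h₃, h₄, h₅⟩ := hf
  obtain ⟨d, d', k₁, k₂, k₃, k₄, k₅⟩ := hg
  refine ⟨Equiv.sumCongr e d, Equiv.sumCongr e' d',
    fun x => (sum_map_split _ _ _ _ x).trans (by simp only [h₁, k₁]; rfl),
    fun x => (sum_map_split _ _ _ _ x).trans (by simp only [h₂, k₂]; rfl),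
    ?_, ?_, ?_⟩ <;> rintro (x | x)
  · exact congrArg Sum.inl (h₃ x)
  · exact congrArg Sum.inr (k₃ x)
  · exact congrArg Sum.inl (h₄ x)
  · exact congrArg Sum.inr (k₄ x)
  · exact h₅ x
  · exact k₅ x

end LCircuit

/-- Morphisms `m ⟶ n` of `Circ L`: isomorphism classes of `L`-circuits. -/
def CircHom (L : Type u) (m n : ℕ) : Type (max 1 u) := Quotient (LCircuit.isoSetoid L m n)

namespace CircHom

variable {L : Type u}

def mk {m n : ℕ} (f : LCircuit L m n) : CircHom L m n := Quotient.mk _ f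

theorem ind {m n : ℕ} {P : CircHom L m n → Prop} (h : ∀ f, P (mk f)) (f) : P f :=
  Quotient.ind h f

/-- A morphism of `FinCospan`, seen as a morphism of `Circ L` without edges. -/
def ofCospanHom {m n : ℕ} : CospanHom m n → CircHom L m n :=
  Quotient.map LCircuit.ofCospan (by
    rintro f g ⟨e, h, h'⟩
    exact ⟨e, Equiv.refl _, h, h', fun a => a.elim, fun a => a.elim, fun a => a.elim⟩)

def id (n : ℕ) : CircHom L n n := ofCospanHom (CospanHom.id n)

def comp {a b c : ℕ} : CircHom L a b → CircHom L b c → CircHom L a c :=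
  Quotient.map₂ LCircuit.comp (fun _ _ h _ _ h' => LCircuit.comp_congr h h')

def tens {a b c d : ℕ} : CircHom L a b → CircHom L c d → CircHom L (a + c) (b + d) :=
  Quotient.map₂ LCircuit.tens (fun _ _ h _ _ h' => LCircuit.tens_congr h h')

theorem mk_eq {m n : ℕ} {f g : LCircuit L m n} (e : f.N ≃ g.N) (e' : f.E ≃ g.E)
    (h₁ : ∀ x, e (f.i x) = g.i x) (h₂ : ∀ y, e (f.o y) = g.o y)
    (h₃ : ∀ a, e (f.s a) = g.s (e' a)) (h₄ : ∀ a, e (f.t a) = g.t (e' a))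
    (h₅ : ∀ a, f.ℓ a = g.ℓ (e' a)) : mk f = mk g := Quotient.sound ⟨e, e', h₁, h₂, h₃, h₄, h₅⟩

theorem tens_mk {a b c d : ℕ} (f : LCircuit L a b) (g : LCircuit L c d) :
    tens (mk f) (mk g) = mk (f.tens g) := rfl

theorem homCast_mk {a a' b b' : ℕ} (ha : a = a') (hb : b = b') (f : LCircuit L a b) :
    homCast ha hb (mk f) = mk (f.reindex ha hb) := by
  subst ha hb; rfl

theorem ofCospanHom_homCast {a a' b b' : ℕ} (ha : a = a') (hb : b = b') (f : CospanHom a b) :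
    (ofCospanHom (homCast ha hb f) : CircHom L a' b') = homCast ha hb (ofCospanHom f) := by
  subst ha hb; rfl

theorem ofCospanHom_comp {a b c : ℕ} (f : CospanHom a b) (g : CospanHom b c) :
    (ofCospanHom (CospanHom.comp f g) : CircHom L a c)
      = comp (ofCospanHom f) (ofCospanHom g) := by
  induction f using CospanHom.ind with | _ f =>
  induction g using CospanHom.ind with | _ g =>
  exact mk_eq (Equiv.refl _) (Equiv.emptySum Empty Empty).symm (fun _ => rfl) (fun _ => rfl)
    (fun a => a.elim) (fun a => a.elim) (fun a => a.elim)

theorem ofCospanHom_tens {a b c d : ℕ} (f : CospanHom a b) (g : CospanHom c d) :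
    (ofCospanHom (CospanHom.tens f g) : CircHom L (a + c) (b + d))
      = tens (ofCospanHom f) (ofCospanHom g) := by
  induction f using CospanHom.ind with | _ f =>
  induction g using CospanHom.ind with | _ g =>
  exact mk_eq (Equiv.refl _) (Equiv.emptySum Empty Empty).symm (fun _ => rfl) (fun _ => rfl)
    (fun a => a.elim) (fun a => a.elim) (fun a => a.elim)

theorem ofFun_comp {a b c : ℕ} (φ : Fin a → Fin b) (g : LCircuit L b c) :
    comp (ofCospanHom (CospanHom.ofFun φ)) (mk g) = mk { g with i := fun x => g.i (φ x) } :=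
  mk_eq (Pushout.idLeft g.i) (Equiv.emptySum Empty g.E) (fun _ => rfl) (fun _ => rfl)
    (by rintro (a | a); exacts [a.elim, rfl]) (by rintro (a | a); exacts [a.elim, rfl])
    (by rintro (a | a); exacts [a.elim, rfl])

theorem comp_ofFun {a b c : ℕ} (f : LCircuit L a b) (e : Fin b ≃ Fin c) :
    comp (mk f) (ofCospanHom (CospanHom.ofFun e)) = mk { f with o := fun x => f.o (e.symm x) } :=
  mk_eq (Pushout.equivRight f.o e) (Equiv.sumEmpty f.E Empty) (fun _ => rfl) (fun _ => rfl)
    (by rintro (a | a); exacts [rfl, a.elim]) (by rintro (a | a); exacts [rfl, a.elim])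
    (by rintro (a | a); exacts [rfl, a.elim])

end CircHom

open CircHom in
/-- The prop `Circ L` of `L`-circuits. -/
def Circ (L : Type u) : PROP.{max 1 u} where
  Hom := CircHom L
  id := CircHom.id
  comp := comp
  tens := tens
  braid a b := ofCospanHom (FinCospan.braid a b)
  id_comp f := by
    induction f using CircHom.ind with | _ f => exact ofFun_comp _ f
  comp_id f := by
    induction f using CircHom.ind with | _ f => exact comp_ofFun f (Equiv.refl _)
  comp_assoc f g h := by
    induction f using CircHom.ind with | _ f =>
    induction g using CircHom.ind with | _ g =>
    induction h using CircHom.ind with | _ h =>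
    exact mk_eq (Pushout.assoc f.o g.i g.o h.i) (Equiv.sumAssoc _ _ _) (fun _ => rfl)
      (fun _ => rfl) (by rintro ((a | a) | a) <;> rfl) (by rintro ((a | a) | a) <;> rfl)
      (by rintro ((a | a) | a) <;> rfl)
  tens_id a b := (ofCospanHom_tens _ _).symm.trans (congrArg ofCospanHom (FinCospan.tens_id a b))
  tens_comp f g f' g' := by
    induction f using CircHom.ind with | _ f =>
    induction g using CircHom.ind with | _ g =>
    induction f' using CircHom.ind with | _ f' =>
    induction g' using CircHom.ind with | _ g' =>
    refine mk_eq (Pushout.sum f.o g.i f'.o g'.i) (Equiv.sumSumSumComm _ _ _ _)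
      (fun x => ?_) (fun x => ?_)
      (by rintro ((a | a) | (a | a)) <;> rfl) (by rintro ((a | a) | (a | a)) <;> rfl)
      (by rintro ((a | a) | (a | a)) <;> rfl) <;>
      refine Fin.addCases (fun x => ?_) (fun x => ?_) x <;>
      simp [Cospan.tens, Cospan.comp, LCircuit.tens, LCircuit.comp] <;> rfl
  tens_assoc {a b c d a' b'} f g h := by
    induction f using CircHom.ind with | _ f =>
    induction g using CircHom.ind with | _ g =>
    induction h using CircHom.ind with | _ h =>
    simp only [tens_mk, homCast_mk]
    exact mk_eq (Equiv.sumAssoc _ _ _) (Equiv.sumAssoc _ _ _)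
      (fun x => sumAssoc_split _ _ _ x) (fun x => sumAssoc_split _ _ _ x)
      (by rintro ((a | a) | a) <;> rfl) (by rintro ((a | a) | a) <;> rfl)
      (by rintro ((a | a) | a) <;> rfl)
  id_tens {a b} f := by
    induction f using CircHom.ind with | _ f =>
    change homCast _ _ (tens (mk (LCircuit.ofCospan (Cospan.ofFun _root_.id))) (mk f)) = _
    simp only [tens_mk, homCast_mk]
    exact mk_eq (Equiv.emptySum (Fin 0) f.N) (Equiv.emptySum Empty f.E)
      (fun x => emptySum_split (_root_.id : Fin 0 → Fin 0) _ x)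
      (fun x => emptySum_split (_root_.id : Fin 0 → Fin 0) _ x)
      (by rintro (a | a); exacts [a.elim, rfl]) (by rintro (a | a); exacts [a.elim, rfl])
      (by rintro (a | a); exacts [a.elim, rfl])
  tens_id_zero {a b} f := by
    induction f using CircHom.ind with | _ f =>
    change homCast _ _ (tens (mk f) (mk (LCircuit.ofCospan (Cospan.ofFun _root_.id)))) = _
    simp only [tens_mk, homCast_mk]
    exact mk_eq (Equiv.sumEmpty f.N (Fin 0)) (Equiv.sumEmpty f.E Empty)
      (fun x => sumEmpty_split _ (_root_.id : Fin 0 → Fin 0) x)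
      (fun x => sumEmpty_split _ (_root_.id : Fin 0 → Fin 0) x)
      (by rintro (a | a); exacts [rfl, a.elim]) (by rintro (a | a); exacts [rfl, a.elim])
      (by rintro (a | a); exacts [rfl, a.elim])
  braid_natural f g := by
    induction f using CircHom.ind with | _ f =>
    induction g using CircHom.ind with | _ g =>
    rw [tens_mk, tens_mk]
    refine (comp_ofFun _ _).trans (Eq.trans ?_ (ofFun_comp _ _).symm)
    refine mk_eq (Equiv.sumComm _ _) (Equiv.sumComm _ _) (fun x => sumComm_split _ _ x)
      (fun x => ?_) (by rintro (a | a) <;> rfl) (by rintro (a | a) <;> rfl)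
      (by rintro (a | a) <;> rfl)
    refine (sumComm_split _ _ _).trans ?_
    exact congrArg (split g.o f.o) (congrFun (flip_flip _ _) x)
  hexagon a b c := by
    have h := congrArg (ofCospanHom (L := L)) (FinCospan.hexagon a b c)
    refine Eq.trans ?_ (h.trans ?_)
    · exact (ofCospanHom_homCast _ _ (FinCospan.braid a (b + c))).symm
    · refine (ofCospanHom_comp (FinCospan.tens (FinCospan.braid a b) (FinCospan.id c))
        (homCast _ _ (FinCospan.tens (FinCospan.id b) (FinCospan.braid a c)))).trans ?_
      congr 1
      · exact ofCospanHom_tens (FinCospan.braid a b) (FinCospan.id c)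
      · exact (ofCospanHom_homCast _ _ _).trans
          (congrArg _ (ofCospanHom_tens (FinCospan.id b) (FinCospan.braid a c)))
  braid_symm a b := (ofCospanHom_comp (FinCospan.braid a b) (FinCospan.braid b a)).symm.trans
    (congrArg ofCospanHom (FinCospan.braid_symm a b))

namespace Circ

/-- The inclusion of `FinCospan` in `Circ L`. -/
def inclusion (L : Type u) : PROP.Mor FinCospan (Circ L) where
  map := CircHom.ofCospanHom
  map_id _ := rfl
  map_comp := CircHom.ofCospanHom_comp
  map_tens := CircHom.ofCospanHom_tens
  map_braid _ _ := rfl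

/-- The generator `1 ⟶ 1` of `Circ L` given by a label. -/
def edge {L : Type u} (l : L) : (Circ L).Hom 1 1 := CircHom.mk (LCircuit.edge l)

/-- The morphism of props that changes the labels of circuits along a function. -/
def relabel {L : Type u} {L' : Type v} (p : L → L') : PROP.Mor (Circ L) (Circ L') where
  map := Quotient.map (LCircuit.relabel p) (by
    rintro f g ⟨e, e', h₁, h₂, h₃, h₄, h₅⟩
    exact ⟨e, e', h₁, h₂, h₃, h₄, fun a => congrArg p (h₅ a)⟩)
  map_id _ := CircHom.mk_eq (Equiv.refl _) (Equiv.refl _) (fun _ => rfl) (fun _ => rfl)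
    (fun a => a.elim) (fun a => a.elim) (fun a => a.elim)
  map_comp f g := by
    induction f using CircHom.ind with | _ f =>
    induction g using CircHom.ind with | _ g =>
    exact CircHom.mk_eq (Equiv.refl _) (Equiv.refl _) (fun _ => rfl) (fun _ => rfl)
      (fun _ => rfl) (fun _ => rfl) (by rintro (a | a) <;> rfl)
  map_tens f g := by
    induction f using CircHom.ind with | _ f =>
    induction g using CircHom.ind with | _ g =>
    exact CircHom.mk_eq (Equiv.refl _) (Equiv.refl _) (fun _ => rfl) (fun _ => rfl)
      (fun _ => rfl) (fun _ => rfl) (by rintro (a | a) <;> rfl)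
  map_braid _ _ := CircHom.mk_eq (Equiv.refl _) (Equiv.refl _) (fun _ => rfl) (fun _ => rfl)
    (fun a => a.elim) (fun a => a.elim) (fun a => a.elim)

end Circ

namespace LCircuit

variable {L : Type u}

theorem Components.glue {m n : ℕ} (f : LCircuit L m n) (a : f.E) :
    (Quot.mk _ (f.s a) : f.Components) = Quot.mk _ (f.t a) := Quot.sound ⟨a, rfl, rfl⟩

theorem components_congr {m n : ℕ} {f g : LCircuit L m n} (h : f ≈ g) :
    f.components ≈ g.components := by
  obtain ⟨e, e', h₁, h₂, h₃, h₄, h₅⟩ := h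
  refine ⟨⟨Quot.lift (fun x => Quot.mk _ (e x)) ?_, Quot.lift (fun x => Quot.mk _ (e.symm x)) ?_,
    ?_, ?_⟩, fun x => congrArg (Quot.mk _) (h₁ x), fun x => congrArg (Quot.mk _) (h₂ x)⟩
  · rintro _ _ ⟨a, rfl, rfl⟩
    simp only [h₃, h₄]; exact Components.glue g _
  · rintro _ _ ⟨a, rfl, rfl⟩
    obtain ⟨a, rfl⟩ := e'.surjective a
    simp only [← h₃, ← h₄, e.symm_apply_apply]; exact Components.glue f _
  · rintro ⟨x⟩; exact congrArg (Quot.mk _) (e.symm_apply_apply x)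
  · rintro ⟨x⟩; exact congrArg (Quot.mk _) (e.apply_symm_apply x)

theorem components_ofCospan {m n : ℕ} (f : Cospan m n) :
    (ofCospan f : LCircuit L m n).components ≈ f := by
  refine ⟨⟨Quot.lift _root_.id ?_, Quot.mk _, ?_, fun _ => rfl⟩, fun _ => rfl, fun _ => rfl⟩
  · rintro _ _ ⟨a, _⟩; exact a.elim
  · rintro ⟨x⟩; rfl

theorem components_comp {a b c : ℕ} (f : LCircuit L a b) (g : LCircuit L b c) :
    (f.comp g).components ≈ f.components.comp g.components := by
  refine ⟨⟨Quot.lift (Pushout.desc (fun x => Pushout.inl _ _ (Quot.mk _ x))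
      (fun x => Pushout.inr _ _ (Quot.mk _ x)) (fun y => ?_)) ?_,
    Pushout.desc (Quot.lift (fun x => Quot.mk _ (Pushout.inl _ _ x)) ?_)
      (Quot.lift (fun x => Quot.mk _ (Pushout.inr _ _ x)) ?_) (fun y => ?_), ?_, ?_⟩,
    fun _ => rfl, fun _ => rfl⟩
  · exact Pushout.glue (f := f.components.o) (g := g.components.i) y
  · rintro _ _ ⟨a | a, rfl, rfl⟩
    · exact congrArg (Pushout.inl _ _) (Components.glue f a)
    · exact congrArg (Pushout.inr _ _) (Components.glue g a)
  · rintro _ _ ⟨a, rfl, rfl⟩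
    exact Components.glue (f.comp g) (Sum.inl a)
  · rintro _ _ ⟨a, rfl, rfl⟩
    exact Components.glue (f.comp g) (Sum.inr a)
  · exact congrArg (Quot.mk _) (Pushout.glue (f := f.o) (g := g.i) y)
  · rintro ⟨x⟩
    revert x
    exact Pushout.ind (fun _ => rfl) (fun _ => rfl)
  · exact Pushout.ind (by rintro ⟨x⟩; rfl) (by rintro ⟨x⟩; rfl)

theorem components_tens {a b c d : ℕ} (f : LCircuit L a b) (g : LCircuit L c d) :
    (f.tens g).components ≈ f.components.tens g.components := by
  refine ⟨⟨Quot.lift (Sum.map (Quot.mk _) (Quot.mk _)) ?_,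
    Sum.elim (Quot.lift (fun x => Quot.mk _ (Sum.inl x)) ?_)
      (Quot.lift (fun x => Quot.mk _ (Sum.inr x)) ?_), ?_, ?_⟩,
    fun x => sum_map_split _ _ _ _ x, fun x => sum_map_split _ _ _ _ x⟩
  · rintro _ _ ⟨a | a, rfl, rfl⟩
    · exact congrArg Sum.inl (Components.glue f a)
    · exact congrArg Sum.inr (Components.glue g a)
  · rintro _ _ ⟨a, rfl, rfl⟩
    exact Components.glue (f.tens g) (Sum.inl a)
  · rintro _ _ ⟨a, rfl, rfl⟩
    exact Components.glue (f.tens g) (Sum.inr a)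
  · rintro ⟨x | x⟩ <;> rfl
  · rintro (⟨⟨x⟩⟩ | ⟨⟨x⟩⟩) <;> rfl

end LCircuit

/-- The morphism of props that replaces the graph of a circuit by its set of connected
components. -/
def Circ.collapse (L : Type u) : PROP.Mor (Circ L) FinCospan where
  map := Quotient.map LCircuit.components (fun _ _ h => LCircuit.components_congr h)
  map_id _ := Quotient.sound (LCircuit.components_ofCospan _)
  map_comp f g := by
    induction f using CircHom.ind with | _ f =>
    induction g using CircHom.ind with | _ g =>
    exact Quotient.sound (LCircuit.components_comp f g)
  map_tens f g := by
    induction f using CircHom.ind with | _ f =>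
    induction g using CircHom.ind with | _ g =>
    exact Quotient.sound (LCircuit.components_tens f g)
  map_braid _ _ := Quotient.sound (LCircuit.components_ofCospan _)

/-! ### Linear relations and Lagrangian relations -/

section Symplectic

variable {k : Type u} [Field k] {V : Type v} [AddCommGroup V] [Module k V]

/-- A subspace on which the bilinear form `ω` vanishes. -/
def IsIsotropic (ω : LinearMap.BilinForm k V) (L : Submodule k V) : Prop :=
  ∀ x ∈ L, ∀ y ∈ L, ω x y = 0

/-- A Lagrangian subspace: an isotropic subspace that is not properly contained in any other
isotropic subspace. -/
def IsLagrangian (ω : LinearMap.BilinForm k V) (L : Submodule k V) : Prop :=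
  IsIsotropic ω L ∧ ∀ M : Submodule k V, IsIsotropic ω M → L ≤ M → M = L

theorem IsLagrangian.mem_of_orthogonal {ω : LinearMap.BilinForm k V} (hω : ∀ x, ω x x = 0)
    {L : Submodule k V} (hL : IsLagrangian ω L) {x : V} (hx : ∀ y ∈ L, ω x y = 0) : x ∈ L := by
  have hsk : ∀ x y, ω x y = - ω y x := by
    intro x y
    have h := hω (x + y)
    simp only [map_add, LinearMap.add_apply, hω] at h
    linear_combination h
  have h := hL.2 (L ⊔ Submodule.span k {x}) (by
    intro a ha b hb
    obtain ⟨a, ha', _, hs, rfl⟩ := Submodule.mem_sup.1 ha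
    obtain ⟨b, hb', _, ht, rfl⟩ := Submodule.mem_sup.1 hb
    obtain ⟨s, rfl⟩ := Submodule.mem_span_singleton.1 hs
    obtain ⟨t, rfl⟩ := Submodule.mem_span_singleton.1 ht
    have h1 := hL.1 a ha' b hb'
    have h2 := hx b hb'
    have h3 : ω a x = 0 := by rw [hsk, hx a ha', neg_zero]
    simp [h1, h2, h3, hω]) le_sup_left
  rw [← h]
  exact Submodule.mem_sup_right (Submodule.mem_span_singleton_self x)

theorem isLagrangian_of_orthogonal {ω : LinearMap.BilinForm k V} {L : Submodule k V}
    (h : IsIsotropic ω L) (h' : ∀ x, (∀ y ∈ L, ω x y = 0) → x ∈ L) : IsLagrangian ω L :=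
  ⟨h, fun _ hM hLM => le_antisymm (fun x hx => h' x fun y hy => hM x hx y (hLM hy)) hLM⟩

end Symplectic

section Relations

variable (k : Type u) [Field k]

/-- The vector space `(k ⊕ k)ⁿ`, whose elements are families `(φ i, I i)` of potentials and
currents. -/
abbrev Phase (n : ℕ) : Type u := Fin n → k × k

/-- The symplectic structure on `(k ⊕ k)ⁿ`: the direct sum of `n` copies of
`ω ((φ, I), (φ', I')) = φ I' - φ' I`. -/
def symp (n : ℕ) : LinearMap.BilinForm k (Phase k n) :=
  LinearMap.mk₂ k (fun x y => ∑ i, ((x i).1 * (y i).2 - (y i).1 * (x i).2))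
    (fun x x' y => by
      rw [← Finset.sum_add_distrib]
      exact Finset.sum_congr rfl fun i _ => by simp only [Pi.add_apply, Prod.fst_add, Prod.snd_add]; ring)
    (fun c x y => by
      rw [smul_eq_mul, Finset.mul_sum]
      exact Finset.sum_congr rfl fun i _ => by simp only [Pi.smul_apply, Prod.smul_fst, Prod.smul_snd, smul_eq_mul]; ring)
    (fun x y y' => by
      rw [← Finset.sum_add_distrib]
      exact Finset.sum_congr rfl fun i _ => by simp only [Pi.add_apply, Prod.fst_add, Prod.snd_add]; ring)
    (fun c x y => by
      rw [smul_eq_mul, Finset.mul_sum]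
      exact Finset.sum_congr rfl fun i _ => by simp only [Pi.smul_apply, Prod.smul_fst, Prod.smul_snd, smul_eq_mul]; ring)

/-- The symplectic structure `(-ω) ⊕ ω` on `(k ⊕ k)ᵐ ⊕ (k ⊕ k)ⁿ`, the first summand carrying the
conjugate of its symplectic structure. -/
def relSymp (m n : ℕ) : LinearMap.BilinForm k (Phase k m × Phase k n) :=
  -(symp k m).compl₁₂ (LinearMap.fst k _ _) (LinearMap.fst k _ _)
    + (symp k n).compl₁₂ (LinearMap.snd k _ _) (LinearMap.snd k _ _)

variable {k}

theorem symp_apply {n : ℕ} (x y : Phase k n) :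
    symp k n x y = ∑ i, ((x i).1 * (y i).2 - (y i).1 * (x i).2) := rfl

theorem relSymp_apply {m n : ℕ} (x y : Phase k m × Phase k n) :
    relSymp k m n x y = -symp k m x.1 y.1 + symp k n x.2 y.2 := rfl

theorem relSymp_self {m n : ℕ} (x : Phase k m × Phase k n) : relSymp k m n x x = 0 := by
  simp [relSymp_apply, symp_apply]

theorem exists_symp_eq {n : ℕ} (f : Module.Dual k (Phase k n)) : ∃ x, ∀ y, symp k n x y = f y := by
  refine ⟨fun i => (f (Pi.single i (0, 1)), -f (Pi.single i (1, 0))), fun y => ?_⟩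
  have hy : y = ∑ i, ((y i).1 • (Pi.single i (1, 0) : Phase k n)
      + (y i).2 • (Pi.single i (0, 1) : Phase k n)) := by
    conv_lhs => rw [← Finset.univ_sum_single y]
    refine Finset.sum_congr rfl fun i _ => ?_
    rw [← Pi.single_smul, ← Pi.single_smul, ← Pi.single_add]
    congr 1
    ext <;> simp
  conv_rhs => rw [hy]
  rw [map_sum, symp_apply]
  refine Finset.sum_congr rfl fun i _ => ?_
  simp only [map_add, map_smul, smul_eq_mul]
  ring

/-- Linear relations from `(k ⊕ k)ᵐ` to `(k ⊕ k)ⁿ`. -/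
abbrev LinRel (k : Type u) [Field k] (m n : ℕ) : Type u := Submodule k (Phase k m × Phase k n)

namespace LinRel

/-- The usual composition of relations. -/
def comp {a b c : ℕ} (L : LinRel k a b) (L' : LinRel k b c) : LinRel k a c where
  carrier := {p | ∃ y, (p.1, y) ∈ L ∧ (y, p.2) ∈ L'}
  zero_mem' := ⟨0, L.zero_mem, L'.zero_mem⟩
  add_mem' := by
    rintro p q ⟨y, h, h'⟩ ⟨z, l, l'⟩
    exact ⟨y + z, L.add_mem h l, L'.add_mem h' l'⟩
  smul_mem' := by
    rintro r p ⟨y, h, h'⟩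
    exact ⟨r • y, L.smul_mem r h, L'.smul_mem r h'⟩

theorem mem_comp {a b c : ℕ} {L : LinRel k a b} {L' : LinRel k b c} {x : Phase k a}
    {z : Phase k c} : (x, z) ∈ L.comp L' ↔ ∃ y, (x, y) ∈ L ∧ (y, z) ∈ L' := Iff.rfl

/-- The direct sum of linear relations. -/
def tens {a b c d : ℕ} (L : LinRel k a b) (L' : LinRel k c d) : LinRel k (a + c) (b + d) where
  carrier := {p | ((fun i => p.1 (Fin.castAdd c i)), fun i => p.2 (Fin.castAdd d i)) ∈ L ∧
    ((fun i => p.1 (Fin.natAdd a i)), fun i => p.2 (Fin.natAdd b i)) ∈ L'}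
  zero_mem' := ⟨L.zero_mem, L'.zero_mem⟩
  add_mem' h l := ⟨L.add_mem h.1 l.1, L'.add_mem h.2 l.2⟩
  smul_mem' r _ h := ⟨L.smul_mem r h.1, L'.smul_mem r h.2⟩

theorem mem_tens {a b c d : ℕ} {L : LinRel k a b} {L' : LinRel k c d} {x : Phase k (a + c)}
    {y : Phase k (b + d)} : (x, y) ∈ L.tens L' ↔
      ((fun i => x (Fin.castAdd c i)), fun i => y (Fin.castAdd d i)) ∈ L ∧
      ((fun i => x (Fin.natAdd a i)), fun i => y (Fin.natAdd b i)) ∈ L' := Iff.rfl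

/-- The linear relation of pairs `(x, y)` with `x i = y (φ i)` for all `i`. For a bijection `φ`
it is the graph of the corresponding permutation of coordinates. -/
def ofFun {m n : ℕ} (φ : Fin m → Fin n) : LinRel k m n where
  carrier := {p | ∀ i, p.1 i = p.2 (φ i)}
  zero_mem' _ := rfl
  add_mem' h l i := congrArg₂ (· + ·) (h i) (l i)
  smul_mem' r _ h i := congrArg (r • ·) (h i)

theorem mem_ofFun {m n : ℕ} {φ : Fin m → Fin n} {x : Phase k m} {y : Phase k n} :
    (x, y) ∈ (ofFun φ : LinRel k m n) ↔ ∀ i, x i = y (φ i) := Iff.rfl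

theorem ofFun_comp_ofFun {a b c : ℕ} (φ : Fin a → Fin b) (ψ : Fin b → Fin c) :
    (ofFun φ : LinRel k a b).comp (ofFun ψ) = ofFun (ψ ∘ φ) := by
  ext ⟨x, z⟩
  simp only [mem_comp, mem_ofFun]
  constructor
  · rintro ⟨y, h, h'⟩ i
    rw [h, h']; rfl
  · intro h
    exact ⟨fun i => z (ψ i), h, fun _ => rfl⟩

theorem ofFun_tens_ofFun {a b c d : ℕ} (φ : Fin a → Fin b) (ψ : Fin c → Fin d) :
    (ofFun φ : LinRel k a b).tens (ofFun ψ) = ofFun (finSum φ ψ) := by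
  ext ⟨x, z⟩
  simp only [mem_tens, mem_ofFun]
  constructor
  · rintro ⟨h, h'⟩ i
    refine Fin.addCases (fun i => ?_) (fun i => ?_) i
    · rw [finSum_castAdd]; exact h i
    · rw [finSum_natAdd]; exact h' i
  · intro h
    refine ⟨fun i => ?_, fun i => ?_⟩
    · rw [h, finSum_castAdd]
    · rw [h, finSum_natAdd]

theorem mem_homCast {a a' b b' : ℕ} (ha : a = a') (hb : b = b') (L : LinRel k a b)
    (x : Phase k a') (y : Phase k b') :
    (x, y) ∈ (homCast (Hom := LinRel k) ha hb L) ↔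
      ((fun i => x (Fin.cast ha i)), fun i => y (Fin.cast hb i)) ∈ L := by
  subst ha hb; rfl

theorem comp_isLagrangian {a b c : ℕ} {L : LinRel k a b} {L' : LinRel k b c}
    (hL : IsLagrangian (relSymp k a b) L) (hL' : IsLagrangian (relSymp k b c) L') :
    IsLagrangian (relSymp k a c) (L.comp L') := by
  refine isLagrangian_of_orthogonal ?_ ?_
  · rintro ⟨x, z⟩ ⟨y, h, h'⟩ ⟨x₂, z₂⟩ ⟨y₂, h₂, h₂'⟩
    have e := hL.1 _ h _ h₂
    have e' := hL'.1 _ h' _ h₂'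
    simp only [relSymp_apply] at e e' ⊢
    linear_combination e + e'
  · rintro ⟨x, z⟩ hxz
    -- the difference of the two middle components, and a functional vanishing on its kernel
    let T : (L × L') →ₗ[k] Phase k b :=
      (LinearMap.snd k _ _ ∘ₗ L.subtype) ∘ₗ LinearMap.fst k _ _
        - (LinearMap.fst k _ _ ∘ₗ L'.subtype) ∘ₗ LinearMap.snd k _ _
    let g : Module.Dual k (L × L') :=
      ((symp k a x ∘ₗ LinearMap.fst k _ _) ∘ₗ L.subtype) ∘ₗ LinearMap.fst k _ _
        - ((symp k c z ∘ₗ LinearMap.snd k _ _) ∘ₗ L'.subtype) ∘ₗ LinearMap.snd k _ _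
    have hg : g ∈ LinearMap.range T.dualMap := by
      rw [LinearMap.range_dualMap_eq_dualAnnihilator_ker, Submodule.mem_dualAnnihilator]
      rintro ⟨⟨⟨x₁, y₁⟩, h₁⟩, ⟨⟨y₂, z₂⟩, h₂⟩⟩ hT
      have hy : y₁ - y₂ = 0 := hT
      obtain rfl := sub_eq_zero.1 hy
      have := hxz (x₁, z₂) ⟨y₁, h₁, h₂⟩
      rw [relSymp_apply] at this
      change symp k a x x₁ - symp k c z z₂ = 0
      linear_combination -this
    obtain ⟨f, hf⟩ := hg
    obtain ⟨y, hy⟩ := exists_symp_eq f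
    have key : ∀ p ∈ L, ∀ q ∈ L', symp k b y p.2 - symp k b y q.1
        = symp k a x p.1 - symp k c z q.2 := by
      intro p hp q hq
      have := LinearMap.congr_fun hf (⟨p, hp⟩, ⟨q, hq⟩)
      rw [hy, hy, ← map_sub]
      exact this
    refine ⟨y, hL.mem_of_orthogonal relSymp_self fun p hp => ?_,
      hL'.mem_of_orthogonal relSymp_self fun q hq => ?_⟩
    · have := key p hp 0 L'.zero_mem
      simp only [Prod.fst_zero, Prod.snd_zero, map_zero, sub_zero] at this
      rw [relSymp_apply]
      linear_combination this
    · have := key 0 L.zero_mem q hq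
      simp only [Prod.fst_zero, Prod.snd_zero, map_zero, zero_sub] at this
      rw [relSymp_apply]
      linear_combination this

theorem relSymp_add {a b c d : ℕ} (x x' : Phase k (a + c)) (y y' : Phase k (b + d)) :
    relSymp k (a + c) (b + d) (x, y) (x', y')
      = relSymp k a b ((fun i => x (Fin.castAdd c i)), fun i => y (Fin.castAdd d i))
          ((fun i => x' (Fin.castAdd c i)), fun i => y' (Fin.castAdd d i))
        + relSymp k c d ((fun i => x (Fin.natAdd a i)), fun i => y (Fin.natAdd b i))
          ((fun i => x' (Fin.natAdd a i)), fun i => y' (Fin.natAdd b i)) := by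
  simp only [relSymp_apply, symp_apply, Fin.sum_univ_add]
  ring

theorem tens_isLagrangian {a b c d : ℕ} {L : LinRel k a b} {L' : LinRel k c d}
    (hL : IsLagrangian (relSymp k a b) L) (hL' : IsLagrangian (relSymp k c d) L') :
    IsLagrangian (relSymp k (a + c) (b + d)) (L.tens L') := by
  refine isLagrangian_of_orthogonal ?_ ?_
  · rintro ⟨x, y⟩ h ⟨x', y'⟩ h'
    rw [relSymp_add, hL.1 _ h.1 _ h'.1, hL'.1 _ h.2 _ h'.2, add_zero]
  · rintro ⟨x, y⟩ h
    refine ⟨hL.mem_of_orthogonal relSymp_self ?_, hL'.mem_of_orthogonal relSymp_self ?_⟩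
    · rintro ⟨x', y'⟩ hp
      have := h (Fin.addCases x' 0, Fin.addCases y' 0) (by
        rw [mem_tens]
        simp only [Fin.addCases_left, Fin.addCases_right]
        exact ⟨hp, L'.zero_mem⟩)
      rw [relSymp_add] at this
      simp only [Fin.addCases_left, Fin.addCases_right] at this
      rwa [show ((fun _ => (0 : Fin c → k × k) _), fun _ => (0 : Fin d → k × k) _)
        = (0 : Phase k c × Phase k d) from rfl, map_zero, add_zero] at this
    · rintro ⟨x', y'⟩ hp
      have := h (Fin.addCases 0 x', Fin.addCases 0 y') (by
        rw [mem_tens]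
        simp only [Fin.addCases_left, Fin.addCases_right]
        exact ⟨L.zero_mem, hp⟩)
      rw [relSymp_add] at this
      simp only [Fin.addCases_left, Fin.addCases_right] at this
      rwa [show ((fun _ => (0 : Fin a → k × k) _), fun _ => (0 : Fin b → k × k) _)
        = (0 : Phase k a × Phase k b) from rfl, map_zero, zero_add] at this

theorem ofFun_isLagrangian {m n : ℕ} (e : Fin m ≃ Fin n) :
    IsLagrangian (relSymp k m n) (ofFun e) := by
  have hsum : ∀ (x : Phase k m) (y y' : Phase k n),
      relSymp k m n (x, y) ((fun i => y' (e i)), y')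
        = -symp k m x (fun i => y' (e i)) + symp k m (fun i => y (e i)) (fun i => y' (e i)) := by
    intro x y y'
    rw [relSymp_apply]
    congr 1
    simp only [symp_apply]
    exact (Equiv.sum_comp e fun j => (y j).1 * (y' j).2 - (y' j).1 * (y j).2).symm
  refine isLagrangian_of_orthogonal ?_ ?_
  · rintro ⟨x, y⟩ h ⟨x', y'⟩ h'
    obtain rfl : x = fun i => y (e i) := funext h
    obtain rfl : x' = fun i => y' (e i) := funext h'
    rw [hsum]; ring
  · rintro ⟨x, y⟩ h i
    have h' : ∀ w : Phase k m, symp k m (x - fun i => y (e i)) w = 0 := by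
      intro w
      have := (hsum x y fun j => w (e.symm j)).symm.trans
        (h ((fun i => w (e.symm (e i))), fun j => w (e.symm j)) (fun _ => rfl))
      simp only [Equiv.symm_apply_apply] at this
      rw [map_sub, LinearMap.sub_apply]
      linear_combination -this
    have h1 := h' (Pi.single i (0, 1))
    have h2 := h' (Pi.single i (1, 0))
    rw [symp_apply, Finset.sum_eq_single i (fun j _ hj => by simp [hj]) (by simp)] at h1 h2
    simp only [Pi.single_eq_same, Pi.sub_apply, Prod.fst_sub, Prod.snd_sub, mul_one, mul_zero,
      zero_mul, one_mul, sub_zero, zero_sub, neg_eq_zero] at h1 h2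
    exact Prod.ext (sub_eq_zero.1 h1) (sub_eq_zero.1 h2)

end LinRel

/-- Linear Lagrangian relations from `(k ⊕ k)ᵐ` to `(k ⊕ k)ⁿ`: Lagrangian subspaces of
`(k ⊕ k)ᵐ ⊕ (k ⊕ k)ⁿ`, the first summand carrying the conjugate symplectic structure. -/
def LagRelHom (k : Type u) [Field k] (m n : ℕ) : Type u :=
  {L : LinRel k m n // IsLagrangian (relSymp k m n) L}

namespace LagRelHom

def comp {a b c : ℕ} (L : LagRelHom k a b) (L' : LagRelHom k b c) : LagRelHom k a c :=
  ⟨L.1.comp L'.1, LinRel.comp_isLagrangian L.2 L'.2⟩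

def tens {a b c d : ℕ} (L : LagRelHom k a b) (L' : LagRelHom k c d) :
    LagRelHom k (a + c) (b + d) :=
  ⟨L.1.tens L'.1, LinRel.tens_isLagrangian L.2 L'.2⟩

/-- The graph of a permutation of coordinates. -/
def ofEquiv {m n : ℕ} (e : Fin m ≃ Fin n) : LagRelHom k m n :=
  ⟨LinRel.ofFun e, LinRel.ofFun_isLagrangian e⟩

theorem homCast_val {a a' b b' : ℕ} (ha : a = a') (hb : b = b') (L : LagRelHom k a b) :
    (homCast ha hb L).1 = homCast (Hom := LinRel k) ha hb L.1 := by
  subst ha hb; rfl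

end LagRelHom

open LagRelHom in
/-- The prop of linear Lagrangian relations. -/
def LagRel (k : Type u) [Field k] : PROP.{u} where
  Hom := LagRelHom k
  id n := ofEquiv (Equiv.refl _)
  comp := comp
  tens := tens
  braid a b := ofEquiv finAddFlip
  id_comp L := by
    refine Subtype.ext (Submodule.ext ?_)
    rintro ⟨x, z⟩
    constructor
    · rintro ⟨y, h, h'⟩
      obtain rfl : x = y := funext h
      exact h'
    · exact fun h => ⟨x, fun _ => rfl, h⟩
  comp_id L := by
    refine Subtype.ext (Submodule.ext ?_)
    rintro ⟨x, z⟩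
    constructor
    · rintro ⟨y, h, h'⟩
      obtain rfl : y = z := funext h'
      exact h
    · exact fun h => ⟨z, h, fun _ => rfl⟩
  comp_assoc L L' L'' := by
    refine Subtype.ext (Submodule.ext ?_)
    rintro ⟨x, z⟩
    constructor
    · rintro ⟨y, ⟨w, h, h'⟩, h''⟩
      exact ⟨w, h, y, h', h''⟩
    · rintro ⟨w, h, y, h', h''⟩
      exact ⟨y, ⟨w, h, h'⟩, h''⟩
  tens_id a b := Subtype.ext ((LinRel.ofFun_tens_ofFun _ _).trans
    (congrArg LinRel.ofFun (finSum_id a b)))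
  tens_comp {a b c a' b' c'} L M L' M' := by
    refine Subtype.ext (Submodule.ext ?_)
    rintro ⟨x, z⟩
    constructor
    · rintro ⟨⟨y, h₁, h₂⟩, ⟨y', h₁', h₂'⟩⟩
      refine ⟨Fin.addCases y y', LinRel.mem_tens.2 ?_, LinRel.mem_tens.2 ?_⟩ <;>
        simp only [Fin.addCases_left, Fin.addCases_right]
      exacts [⟨h₁, h₁'⟩, ⟨h₂, h₂'⟩]
    · rintro ⟨y, h, h'⟩
      exact ⟨⟨_, h.1, h'.1⟩, ⟨_, h.2, h'.2⟩⟩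
  tens_assoc {a b c d a' b'} L L' L'' := by
    refine Subtype.ext (Submodule.ext ?_)
    rintro ⟨x, z⟩
    rw [homCast_val, LinRel.mem_homCast]
    have e : ∀ {p q r : ℕ} (i : Fin r), Fin.cast (Nat.add_assoc p q r) (Fin.natAdd (p + q) i)
        = Fin.natAdd p (Fin.natAdd q i) := by
      intro p q r i; ext; simp [Nat.add_assoc]
    have e₂ : ∀ {p q r : ℕ} (i : Fin q),
        Fin.cast (Nat.add_assoc p q r) (Fin.castAdd r (Fin.natAdd p i))
          = Fin.natAdd p (Fin.castAdd r i) := fun _ => rfl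
    have e₃ : ∀ {p q r : ℕ} (i : Fin p),
        Fin.cast (Nat.add_assoc p q r) (Fin.castAdd r (Fin.castAdd q i))
          = Fin.castAdd (q + r) i := fun _ => rfl
    simp only [tens, LinRel.mem_tens, e, e₂, e₃, and_assoc]
  id_tens {a b} L := by
    refine Subtype.ext (Submodule.ext ?_)
    rintro ⟨x, z⟩
    rw [homCast_val, LinRel.mem_homCast]
    have e : ∀ {p : ℕ} (i : Fin p), Fin.cast (Nat.zero_add p) (Fin.natAdd 0 i) = i := by
      intro p i; ext; simp
    simp only [tens, LinRel.mem_tens, e]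
    exact ⟨fun h => h.2, fun h => ⟨fun i => i.elim0, h⟩⟩
  tens_id_zero {a b} L := by
    refine Subtype.ext (Submodule.ext ?_)
    rintro ⟨x, z⟩
    rw [homCast_val, LinRel.mem_homCast]
    exact ⟨fun h => h.1, fun h => ⟨h, fun i => i.elim0⟩⟩
  braid_natural {a b c d} L L' := by
    refine Subtype.ext (Submodule.ext ?_)
    rintro ⟨x, z⟩
    constructor
    · rintro ⟨y, ⟨h, h'⟩, hy⟩
      obtain rfl : y = fun i => z (finAddFlip i) := funext hy
      refine ⟨fun i => x (finAddFlip i), fun i => ?_, ?_⟩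
      · exact congrArg x (congrFun (flip_flip a c) i).symm
      · refine LinRel.mem_tens.2 ?_
        simp only [finAddFlip_apply_castAdd, finAddFlip_apply_natAdd] at h h' ⊢
        exact ⟨h', h⟩
    · rintro ⟨y, hy, ⟨h, h'⟩⟩
      obtain rfl : x = fun i => y (finAddFlip i) := funext hy
      refine ⟨fun i => z (finAddFlip i), ?_, fun i => rfl⟩
      refine LinRel.mem_tens.2 ?_
      simp only [finAddFlip_apply_castAdd, finAddFlip_apply_natAdd] at h h' ⊢
      exact ⟨h', h⟩
  hexagon a b c := by
    have hc : ∀ {a a' b b' : ℕ} (ha : a = a') (hb : b = b') (φ : Fin a → Fin b),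
        homCast (Hom := LinRel k) ha hb (LinRel.ofFun φ)
          = LinRel.ofFun (Fin.cast hb ∘ φ ∘ Fin.cast ha.symm) := by
      intro a a' b b' ha hb φ
      subst ha hb; rfl
    refine Subtype.ext ?_
    rw [homCast_val]
    change homCast (Hom := LinRel k) _ _ (LinRel.ofFun _) = LinRel.comp
      (LinRel.tens (LinRel.ofFun _) (LinRel.ofFun _)) (homCast (Hom := LagRelHom k) _ _ _).1
    rw [homCast_val]
    change _ = LinRel.comp _ (homCast (Hom := LinRel k) _ _
      (LinRel.tens (LinRel.ofFun _) (LinRel.ofFun _)))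
    rw [LinRel.ofFun_tens_ofFun, LinRel.ofFun_tens_ofFun, hc, hc, LinRel.ofFun_comp_ofFun]
    exact congrArg LinRel.ofFun (flip_hexagon a b c)
  braid_symm a b := Subtype.ext ((LinRel.ofFun_comp_ofFun _ _).trans
    (congrArg LinRel.ofFun (flip_flip a b)))

end Relations

/-! ### Black-boxing of corelations -/

open Classical in
/-- The linear relation imposed by a corelation `R` between the potentials and currents
`(φ i, I i)` at its inputs and `(φ' j, I' j)` at its outputs: the potential is constant on each
block, and on each block the sum of the input currents equals the sum of the output currents. -/
def Corel.behavior (k : Type u) [Field k] {m n : ℕ} (R : Corel m n) : LinRel k m n where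
  carrier := {p | (∀ s t, R.Rel s t → Sum.elim (fun i => (p.1 i).1) (fun j => (p.2 j).1) s
        = Sum.elim (fun i => (p.1 i).1) (fun j => (p.2 j).1) t) ∧
    ∀ s, ∑ i with R.Rel (Sum.inl i) s, (p.1 i).2 = ∑ j with R.Rel (Sum.inr j) s, (p.2 j).2}
  zero_mem' := ⟨by rintro (i | i) (j | j) _ <;> rfl, fun s => by simp⟩
  add_mem' := by
    rintro p q ⟨h, h'⟩ ⟨l, l'⟩
    refine ⟨fun s t hst => ?_, fun s => ?_⟩
    · have e := congrArg₂ (· + ·) (h s t hst) (l s t hst)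
      rcases s with s | s <;> rcases t with t | t <;> exact e
    · simp only [Prod.fst_add, Prod.snd_add, Pi.add_apply, Finset.sum_add_distrib, h', l']
  smul_mem' := by
    rintro r p ⟨h, h'⟩
    refine ⟨fun s t hst => ?_, fun s => ?_⟩
    · have e := congrArg (r * ·) (h s t hst)
      rcases s with s | s <;> rcases t with t | t <;> exact e
    · simp only [Prod.smul_fst, Prod.smul_snd, Pi.smul_apply, smul_eq_mul, ← Finset.mul_sum, h']

namespace Corel

variable {k : Type u} [Field k]

/-- A family of potentials and currents belongs to the behavior of the corelation of a cospan
as soon as the potentials come from potentials on the apex, and Kirchhoff's current law holds in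
the weak sense. -/
theorem mem_behavior_of_cospan {m n : ℕ} (f : Cospan m n) {x : Phase k m} {y : Phase k n}
    (h : ∃ ψ : f.N → k, (∀ i, (x i).1 = ψ (f.i i)) ∧ ∀ j, (y j).1 = ψ (f.o j))
    (h' : ∀ χ : f.N → k, ∑ i, χ (f.i i) * (x i).2 = ∑ j, χ (f.o j) * (y j).2) :
    (x, y) ∈ f.toCorel.behavior k := by
  classical
  obtain ⟨ψ, hx, hy⟩ := h
  refine ⟨fun s t hst => ?_, fun s => ?_⟩
  · have e : ∀ s, Sum.elim (fun i => (x i).1) (fun j => (y j).1) s = ψ (Sum.elim f.i f.o s) := by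
      rintro (s | s)
      exacts [hx s, hy s]
    rw [e, e]
    exact congrArg ψ hst
  · have := h' (fun p => if p = Sum.elim f.i f.o s then 1 else 0)
    simp only [ite_mul, one_mul, zero_mul, ← Finset.sum_filter] at this
    exact (Finset.sum_congr (Finset.filter_congr fun _ _ => Iff.rfl) fun _ _ => rfl).trans
      (this.trans (Finset.sum_congr (Finset.filter_congr fun _ _ => Iff.rfl) fun _ _ => rfl))

/-- Conversely, elements of the behavior satisfy both conditions on the set of blocks. -/
theorem behavior_spec {m n : ℕ} {R : Corel m n} {x : Phase k m} {y : Phase k n}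
    (h : (x, y) ∈ R.behavior k) :
    (∃ ψ : R.toCospan.N → k, (∀ i, (x i).1 = ψ (R.toCospan.i i)) ∧
      ∀ j, (y j).1 = ψ (R.toCospan.o j)) ∧
    ∀ χ : R.toCospan.N → k,
      ∑ i, χ (R.toCospan.i i) * (x i).2 = ∑ j, χ (R.toCospan.o j) * (y j).2 := by
  classical
  obtain ⟨h, h'⟩ := h
  refine ⟨⟨Quotient.lift _ h, fun _ => rfl, fun _ => rfl⟩, fun χ => ?_⟩
  have : Fintype R.toCospan.N := Fintype.ofFinite _
  rw [← Finset.sum_fiberwise Finset.univ R.toCospan.i,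
    ← Finset.sum_fiberwise Finset.univ R.toCospan.o]
  refine Finset.sum_congr rfl fun q _ => ?_
  obtain ⟨s, rfl⟩ := Quotient.exists_rep q
  have e : ∀ i, R.toCospan.i i = Quotient.mk R s ↔ R.Rel (Sum.inl i) s := fun i => Quotient.eq
  have e' : ∀ j, R.toCospan.o j = Quotient.mk R s ↔ R.Rel (Sum.inr j) s := fun j => Quotient.eq
  have l : ∀ i ∈ Finset.univ.filter (fun i => R.toCospan.i i = Quotient.mk R s),
      χ (R.toCospan.i i) * (x i).2 = χ (Quotient.mk R s) * (x i).2 :=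
    fun i hi => by rw [(Finset.mem_filter.1 hi).2]
  have l' : ∀ j ∈ Finset.univ.filter (fun j => R.toCospan.o j = Quotient.mk R s),
      χ (R.toCospan.o j) * (y j).2 = χ (Quotient.mk R s) * (y j).2 :=
    fun j hj => by rw [(Finset.mem_filter.1 hj).2]
  rw [Finset.sum_congr rfl l, Finset.sum_congr rfl l', ← Finset.mul_sum, ← Finset.mul_sum]
  congr 1
  have := h' s
  convert this using 2
  · ext i; simp [e]
  · ext j; simp [e']

theorem behavior_isLagrangian {m n : ℕ} (R : Corel m n) :
    IsLagrangian (relSymp k m n) (R.behavior k) := by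
  classical
  refine isLagrangian_of_orthogonal ?_ ?_
  · rintro ⟨x, y⟩ h ⟨x', y'⟩ h'
    obtain ⟨⟨ψ, hx, hy⟩, hχ⟩ := behavior_spec h
    obtain ⟨⟨ψ', hx', hy'⟩, hχ'⟩ := behavior_spec h'
    have e := hχ ψ'
    have e' := hχ' ψ
    simp only [← hx, ← hy, ← hx', ← hy'] at e e'
    simp only [relSymp_apply, symp_apply, Finset.sum_sub_distrib]
    linear_combination e - e'
  · rintro ⟨x, y⟩ h
    refine ⟨?_, fun s => ?_⟩
    · -- test against a unit current flowing from `s` to `t`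
      intro s t hst
      let c : Fin m ⊕ Fin n → k := fun r => (if r = s then 1 else 0) - (if r = t then 1 else 0)
      have hc : ∀ r, (∑ i with R.Rel (Sum.inl i) r, c (Sum.inl i))
          + ∑ j with R.Rel (Sum.inr j) r, c (Sum.inr j) = 0 := by
        intro r
        rw [Finset.sum_filter, Finset.sum_filter,
          ← Fintype.sum_sum_type (fun p => if R.Rel p r then c p else 0)]
        have hsplit : ∀ p, (if R.Rel p r then c p else 0)
            = (if p = s then (if R.Rel s r then 1 else 0) else 0)
              - (if p = t then (if R.Rel t r then (1 : k) else 0) else 0) := by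
          intro p
          by_cases h1 : p = s <;> by_cases h2 : p = t <;> by_cases h3 : R.Rel p r <;>
            simp_all [c]
        have hrs : R.Rel s r ↔ R.Rel t r :=
          ⟨fun h => Setoid.trans' R (Setoid.symm' R hst) h, fun h => Setoid.trans' R hst h⟩
        rw [Finset.sum_congr rfl fun p _ => hsplit p, Finset.sum_sub_distrib]
        simp [hrs]
      have := h ((fun i => (0, c (Sum.inl i))), fun j => (0, -c (Sum.inr j))) (by
        refine ⟨by rintro (i | i) (j | j) _ <;> rfl, fun r => ?_⟩
        simp only [Finset.sum_neg_distrib]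
        exact eq_neg_of_add_eq_zero_left (by convert hc r))
      simp only [relSymp_apply, symp_apply, zero_mul, sub_zero, mul_neg,
        Finset.sum_neg_distrib] at this
      have e : ∑ p, Sum.elim (fun i => (x i).1) (fun j => (y j).1) p * c p = 0 := by
        rw [Fintype.sum_sum_type]
        simp only [Sum.elim_inl, Sum.elim_inr]
        linear_combination -this
      simp only [c, mul_sub, mul_ite, mul_one, mul_zero, Finset.sum_sub_distrib,
        Finset.sum_ite_eq', Finset.mem_univ, if_true] at e
      exact sub_eq_zero.1 e
    · -- test against the potential that is one on the block of `s` and zero elsewhere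
      have := h ((fun i => (if R.Rel (Sum.inl i) s then 1 else 0, 0)),
          fun j => (if R.Rel (Sum.inr j) s then 1 else 0, 0)) (by
        refine ⟨?_, fun r => by simp⟩
        intro p q hpq
        have hrs : R.Rel p s ↔ R.Rel q s :=
          ⟨fun h => Setoid.trans' R (Setoid.symm' R hpq) h, fun h => Setoid.trans' R hpq h⟩
        have e : ∀ p, Sum.elim (fun i => if R.Rel (Sum.inl i) s then (1 : k) else 0)
            (fun j => if R.Rel (Sum.inr j) s then 1 else 0) p = if R.Rel p s then 1 else 0 := by
          rintro (p | p) <;> rfl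
        refine (e p).trans (Eq.trans ?_ (e q).symm)
        simp only [hrs])
      simp only [relSymp_apply, symp_apply, mul_zero, zero_sub, ite_mul, one_mul, zero_mul,
        Finset.sum_neg_distrib, ← Finset.sum_filter, neg_neg] at this
      have := eq_of_sub_eq_zero ((sub_eq_add_neg _ _).trans this)
      convert this

end Corel

/-- A Lagrangian relation contained in another one is equal to it. -/
theorem LagRelHom.eq_of_le {k : Type u} [Field k] {m n : ℕ} {L L' : LagRelHom k m n}
    (h : L.1 ≤ L'.1) : L = L' :=
  Subtype.ext (L.2.2 _ L'.2.1 h).symm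

open Corel in
/-- The morphism of props `K`, sending a corelation to the Lagrangian relation it imposes between
potentials and currents. Its values on the generators of `FinCorel` are computed in
`K_spider`. -/
def K (k : Type u) [Field k] : PROP.Mor FinCorel (LagRel k) where
  map R := ⟨R.behavior k, R.behavior_isLagrangian⟩
  map_id n := by
    refine (LagRelHom.eq_of_le ?_).symm
    rintro ⟨x, y⟩ h
    obtain rfl : x = y := funext h
    exact mem_behavior_of_cospan _ ⟨fun i => (x i).1, fun _ => rfl, fun _ => rfl⟩ fun _ => rfl
  map_comp R S := by
    refine (LagRelHom.eq_of_le ?_).symm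
    rintro ⟨x, z⟩ ⟨y, h, h'⟩
    obtain ⟨⟨ψ, hx, hy⟩, hχ⟩ := behavior_spec h
    obtain ⟨⟨ψ', hy', hz⟩, hχ'⟩ := behavior_spec h'
    refine mem_behavior_of_cospan _ ⟨Pushout.desc ψ ψ' fun j => ?_, hx, hz⟩ fun χ => ?_
    · rw [← hy, ← hy']
    · refine (hχ fun p => χ (Pushout.inl _ _ p)).trans (Eq.trans ?_
        (hχ' fun p => χ (Pushout.inr _ _ p)))
      exact Finset.sum_congr rfl fun j _ => by rw [Pushout.glue]
  map_tens R S := by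
    refine (LagRelHom.eq_of_le ?_).symm
    rintro ⟨x, y⟩ ⟨h, h'⟩
    obtain ⟨⟨ψ, hx, hy⟩, hχ⟩ := behavior_spec h
    obtain ⟨⟨ψ', hx', hy'⟩, hχ'⟩ := behavior_spec h'
    refine mem_behavior_of_cospan _ ⟨Sum.elim ψ ψ', fun i => ?_, fun j => ?_⟩ fun χ => ?_
    · refine Fin.addCases (fun i => ?_) (fun i => ?_) i
      · simpa [Cospan.tens] using hx i
      · simpa [Cospan.tens] using hx' i
    · refine Fin.addCases (fun i => ?_) (fun i => ?_) j
      · simpa [Cospan.tens] using hy i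
      · simpa [Cospan.tens] using hy' i
    · rw [Fin.sum_univ_add, Fin.sum_univ_add]
      simp only [Cospan.tens, split_castAdd, split_natAdd]
      exact congrArg₂ (· + ·) (hχ fun p => χ (Sum.inl p)) (hχ' fun p => χ (Sum.inr p))
  map_braid a b := by
    refine (LagRelHom.eq_of_le ?_).symm
    rintro ⟨x, y⟩ h
    refine mem_behavior_of_cospan _ ⟨fun i => (y i).1, fun i => congrArg Prod.fst (h i),
      fun _ => rfl⟩ fun χ => ?_
    have hx : x = fun i => y (finAddFlip i) := funext h
    subst hx
    exact Equiv.sum_comp finAddFlip fun j => χ j * (y j).2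

/-- The cospan with a single node: for `m, n` equal to `2, 1`, `0, 1`, `1, 2` and `1, 0` these are
the multiplication, unit, comultiplication and counit of the Frobenius monoid `1`. -/
def FinCospan.spider (m n : ℕ) : FinCospan.Hom m n :=
  CospanHom.mk { N := Unit, i := fun _ => (), o := fun _ => () }

section Generators

variable {k : Type u} [Field k]

/-- On the spider `m ⟶ n` all potentials are equal and the sum of the input currents equals the sum
of the output currents (there is no condition if there are no terminals). -/
theorem K_spider {m n : ℕ} (x : Phase k m) (y : Phase k n) :
    (x, y) ∈ ((K k).map (H.map (FinCospan.spider m n))).1 ↔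
      (∃ φ, (∀ i, (x i).1 = φ) ∧ ∀ j, (y j).1 = φ) ∧
        (0 < m + n → ∑ i, (x i).2 = ∑ j, (y j).2) := by
  have hR : ∀ s t, Corel.Rel (H.map (FinCospan.spider m n)) s t := by
    rintro (s | s) (t | t) <;> rfl
  constructor
  · rintro ⟨h, h'⟩
    refine ⟨?_, fun hmn => ?_⟩
    · rcases isEmpty_or_nonempty (Fin m ⊕ Fin n) with hE | ⟨⟨s⟩⟩
      · exact ⟨0, fun i => hE.elim (Sum.inl i), fun j => hE.elim (Sum.inr j)⟩
      · exact ⟨_, fun i => h (Sum.inl i) s (hR _ _), fun j => h (Sum.inr j) s (hR _ _)⟩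
    · obtain ⟨s⟩ : Nonempty (Fin m ⊕ Fin n) := ⟨finSumFinEquiv.symm ⟨0, hmn⟩⟩
      have := h' s
      simpa only [hR, Finset.filter_true] using this
  · rintro ⟨⟨φ, hx, hy⟩, h⟩
    refine ⟨?_, fun s => ?_⟩
    · rintro (s | s) (t | t) _ <;> simp [hx, hy]
    · simp only [hR, Finset.filter_true]
      exact h (by rcases s with s | s <;> have := s.pos <;> omega)

end Generators

/-- Black-boxing of circuits made of perfect wire: the composite `K ∘ H ∘ H'`, where `H'` is
`Circ.collapse`. -/
def idealBlackBox (k : Type u) [Field k] : PROP.Mor (Circ Unit) (LagRel k) :=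
  ((Circ.collapse Unit).trans H).trans (K k)

/-- The two properties that define black-boxing of linear circuits: on circuits without edges it is
the composite of `H` and `K`, and a single edge of impedance `Z` is sent to the relation
`φ₂ - φ₁ = Z I₁`, `I₁ = I₂`, where `x 0 = (φ₁, I₁)` and `y 0 = (φ₂, I₂)`. -/
structure IsBlackBoxing {k : Type u} [Field k] (B : PROP.Mor (Circ k) (LagRel k)) : Prop where
  restrict : (Circ.inclusion k).trans B = H.trans (K k)
  impedance : ∀ (Z : k) (x y : Phase k 1), (x, y) ∈ (B.map (Circ.edge Z)).1 ↔
    (y 0).1 - (x 0).1 = Z * (x 0).2 ∧ (x 0).2 = (y 0).2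

end BlackBoxing

/-! Uniqueness is a matter of generators. Any circuit can be stripped of one edge by turning the two
ends of that edge into extra outputs and then gluing on a copy of the edge bent so that both its
ends are inputs (`CircHom.mk_option`). The bent edge is itself built from a single labelled edge, an
identity wire and a cospan. Induction on the number of edges shows that cospans and edges generate
`Circ L` under composition and tensor product (`CircHom.generation`), so a morphism of props out of
`Circ L` is determined by its values on them (`Circ.mor_ext`).

For existence, a circuit is sent to its physical behavior: the boundary potentials and currents that
extend to potentials on the nodes and currents along the edges obeying Ohm's and Kirchhoff's laws.
This definition is visibly invariant under isomorphism, but two things are not evident: that the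
behavior is Lagrangian, and that it is functorial. Both come from the maximality of Lagrangian
subspaces, as follows.

Every behavior is isotropic. This is the reciprocity theorem for circuits: the power of one
solution's currents against the other solution's potentials is symmetric in the two solutions,
because an edge contributes `Z J J'` (`LCircuit.behavior_isIsotropic`). Moreover solutions on two
circuits that agree on the common boundary glue, so the composite of the behaviors is contained in
the behavior of the composite, and likewise for tensor products. The behavior of a circuit without
edges contains the Lagrangian relation given by `K` and `H`, and the behavior of one edge is
Lagrangian by direct computation. An isotropic subspace containing a Lagrangian one is equal to it,
so generation shows that all behaviors are Lagrangian. Once they are, each of these inclusions is an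
equality, which gives functoriality and the prescribed restriction to cospans. The reverse
inclusions never have to be proved by hand.

The statement on ideal wires is again a comparison on generators: an edge of impedance zero imposes
equal potentials and equal currents, which is the identity relation, and contracting a single edge
also gives the identity. -/

namespace BlackBoxing

/-! ### Circuits are generated by cospans and edges -/

namespace CircHom

variable {L : Type u}

/-- An edge labelled `l` whose two end nodes are both inputs. -/
def bentEdge (l : L) : CircHom L (1 + 1) 0 :=
  comp (tens (mk (LCircuit.edge l)) (id 1)) (ofCospanHom (FinCospan.spider (1 + 1) 0))

/-- The cospan `2 ⟶ 0` merges the output of the edge with the identity wire, so the second input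
lands on the target node. This explicit form makes the pushout in `mk_option` computable. -/
theorem bentEdge_eq (l : L) : bentEdge l = mk
    { N := Fin (1 + 1)
      i := fun x => x
      o := Fin.elim0
      E := Unit
      s := fun _ => 0
      t := fun _ => 1
      ℓ := fun _ => l } := by
  -- The nodes of the edge keep their names; the node of the identity wire and the node of the
  -- spider both become node `1`, the target of the edge.
  refine mk_eq (L := L) (f := LCircuit.comp ((LCircuit.edge l).tens (LCircuit.ofCospan
      (Cospan.ofFun _root_.id))) (LCircuit.ofCospan ⟨Unit, fun _ => (), fun _ => ()⟩))
    ⟨Pushout.desc (Sum.elim _root_.id fun _ => 1) (fun _ => 1) ?_,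
      fun p => Pushout.inl _ _ (Sum.inl p), ?_, ?_⟩
    ⟨fun _ => (), fun _ => Sum.inl (Sum.inl ()), ?_, fun _ => rfl⟩ ?_ (fun y => y.elim0)
    ?_ ?_ ?_
  · intro y
    refine Fin.addCases (fun x => ?_) (fun x => ?_) y <;>
      (obtain rfl : x = 0 := Subsingleton.elim _ _; rfl)
  · have glue := fun y : Fin (1 + 1) => Pushout.glue
      (f := split (fun _ : Fin 1 => (1 : Fin 2)) (_root_.id : Fin 1 → Fin 1))
      (g := fun _ : Fin (1 + 1) => ()) y
    refine Pushout.ind ?_ fun _ => glue (Fin.castAdd 1 0)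
    rintro (x | (x : Fin 1))
    · rfl
    · obtain rfl : x = 0 := Subsingleton.elim _ _
      -- The wire is identified with the target only through the spider, hence two gluings.
      exact (glue (Fin.castAdd 1 0)).trans (glue (Fin.natAdd 1 0)).symm
  · intro x; rfl
  · rintro ((_ | a) | a)
    exacts [rfl, a.elim, a.elim]
  · intro x
    refine Fin.addCases (fun x => ?_) (fun x => ?_) x
    · obtain rfl : x = 0 := Subsingleton.elim _ _
      rfl
    · obtain rfl : x = 0 := Subsingleton.elim _ _
      rfl
  all_goals
    rintro ((_ | a) | a)
    exacts [rfl, a.elim, a.elim]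

/-- A circuit with a distinguished edge is obtained from the circuit without that edge by
exposing its two ends as outputs and gluing the edge to them. -/
theorem mk_option {m n : ℕ} {E : Type} [Finite E] (c : Cospan m n) (s t : Option E → c.N)
    (ℓ : Option E → L) :
    (mk { c with E := Option E, s := s, t := t, ℓ := ℓ } : CircHom L m n)
      = comp (mk
          { N := c.N
            i := c.i
            o := Fin.addCases c.o (Fin.addCases (fun _ : Fin 1 => s none) fun _ : Fin 1 => t none)
            E := E
            s := fun a => s (some a)
            t := fun a => t (some a)
            ℓ := fun a => ℓ (some a) } : CircHom L m (n + (1 + 1)))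
        (tens (id n) (bentEdge (ℓ none))) := by
  rw [bentEdge_eq]
  let ends : Fin (1 + 1) → c.N := Fin.addCases (fun _ : Fin 1 => s none) fun _ : Fin 1 => t none
  let o : Fin (n + (1 + 1)) → c.N := Fin.addCases c.o ends
  have glue := fun y => Pushout.glue (f := o)
    (g := split (_root_.id : Fin n → Fin n) (fun x : Fin (1 + 1) => x)) y
  have hl : ∀ x, o (Fin.castAdd (1 + 1) x) = c.o x := fun x => Fin.addCases_left _
  have hr : ∀ x, o (Fin.natAdd n x) = ends x := fun x => Fin.addCases_right _
  have gl : ∀ x, Pushout.inl o (split (_root_.id : Fin n → Fin n) (fun x : Fin (1 + 1) => x))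
      (c.o x) = Pushout.inr _ _ (Sum.inl x) := fun x => by
    have := glue (Fin.castAdd (1 + 1) x)
    rwa [hl, split_castAdd] at this
  have gr : ∀ x, Pushout.inl o (split (_root_.id : Fin n → Fin n) (fun x : Fin (1 + 1) => x))
      (ends x) = Pushout.inr _ _ (Sum.inr x) := fun x => by
    have := glue (Fin.natAdd n x)
    rwa [hr, split_natAdd] at this
  have hd : ∀ y, o y = Sum.elim c.o ends
      (split (_root_.id : Fin n → Fin n) (fun x : Fin (1 + 1) => x) y) := by
    refine Fin.addCases (fun x => ?_) fun x => ?_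
    · rw [hl, split_castAdd]; rfl
    · rw [hr, split_natAdd]; rfl
  -- The second factor adds no new nodes: each of its nodes is an input, glued to a node of `c`.
  -- Hence the pushout retracts onto `c.N`, identity wires going to the old outputs and the ends of
  -- the bent edge to the source and target of `none`.
  refine Eq.symm (mk_eq (L := L) (f := LCircuit.comp ⟨⟨c.N, c.i, o⟩, E, fun a => s (some a),
      fun a => t (some a), fun a => ℓ (some a)⟩
      ((LCircuit.ofCospan (Cospan.ofFun _root_.id)).tens ⟨⟨Fin (1 + 1), fun x => x, Fin.elim0⟩,
        Unit, fun _ => 0, fun _ => 1, fun _ => ℓ none⟩))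
    ⟨Pushout.desc _root_.id (Sum.elim c.o ends) hd,
      fun p => Pushout.inl _ _ p, ?_, fun _ => rfl⟩
    ⟨Sum.elim some fun _ => none, fun a => a.elim (Sum.inr (Sum.inr ())) Sum.inl, ?_, ?_⟩
    (fun _ => rfl) ?_ ?_ ?_ ?_)
  · refine Pushout.ind (fun _ => rfl) ?_
    rintro (x | x)
    exacts [gl x, gr x]
  · rintro (a | a | a)
    exacts [rfl, a.elim, rfl]
  · rintro (_ | a) <;> rfl
  · intro y
    -- The outputs of the composite are indexed by `n + 0`, which is `n` by definition, so `y` is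
    -- read as `Fin.castAdd 0 y`.
    exact congrArg (Pushout.desc (f := o)
      (g := split (_root_.id : Fin n → Fin n) (fun x : Fin (1 + 1) => x)) _root_.id
        (Sum.elim c.o ends) hd)
      (congrArg (Pushout.inr _ _)
        (split_castAdd (_root_.id : Fin n → Fin n) (Fin.elim0 : Fin 0 → Fin (1 + 1)) y))
  all_goals
    rintro (a | a | a)
    exacts [rfl, a.elim, rfl]

/-- Circuits are generated, under composition and disjoint union, by cospans and edges. -/
theorem generation {P : ∀ {m n : ℕ}, CircHom L m n → Prop}
    (cospan : ∀ {m n : ℕ} (f : CospanHom m n), P (ofCospanHom f))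
    (edge : ∀ l, P (mk (LCircuit.edge l)))
    (comp : ∀ {a b c : ℕ} (f : CircHom L a b) (g : CircHom L b c), P f → P g → P (comp f g))
    (tens : ∀ {a b c d : ℕ} (f : CircHom L a b) (g : CircHom L c d), P f → P g → P (tens f g))
    {m n : ℕ} (f : CircHom L m n) : P f := by
  -- The arities and the cospan are generalized along with the edges, because removing an edge
  -- replaces `n` by `n + 2` outputs.
  have key : ∀ (E : Type) [Finite E], ∀ {m n : ℕ} (c : Cospan m n) (s t : E → c.N) (ℓ : E → L),
      P (mk { c with E := E, s := s, t := t, ℓ := ℓ } : CircHom L m n) := by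
    intro E _
    refine Finite.induction_empty_option (P := fun E => ∀ [Finite E], ∀ {m n : ℕ}
      (c : Cospan m n) (s t : E → c.N) (ℓ : E → L),
      P (mk { c with E := E, s := s, t := t, ℓ := ℓ } : CircHom L m n)) ?_ ?_ ?_ E
    · intro E E' e h _ m n c s t ℓ
      have := Finite.of_equiv _ e.symm
      have h' := h c (s ∘ e) (t ∘ e) (ℓ ∘ e)
      rwa [mk_eq (L := L) (f := { c with E := E, s := s ∘ e, t := t ∘ e, ℓ := ℓ ∘ e })
        (g := { c with E := E', s := s, t := t, ℓ := ℓ }) (Equiv.refl _) e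
        (fun _ => rfl) (fun _ => rfl) (fun _ => rfl) (fun _ => rfl) (fun _ => rfl)] at h'
    · intro _ m n c s t ℓ
      have h := cospan (CospanHom.mk c)
      rwa [show ofCospanHom (CospanHom.mk c) = mk { c with E := PEmpty, s := s, t := t, ℓ := ℓ }
        from mk_eq (Equiv.refl _) (Equiv.equivPEmpty Empty) (fun _ => rfl) (fun _ => rfl)
          (fun a => a.elim) (fun a => a.elim) (fun a => a.elim)] at h
    · intro E _ h _ m n c s t ℓ
      rw [mk_option]
      exact comp _ _ (h _ _ _ _) (tens _ _ (cospan _)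
        (comp _ _ (tens _ _ (edge _) (cospan _)) (cospan _)))
  induction f using CircHom.ind with | _ f => exact key f.E f.toCospan f.s f.t f.ℓ

end CircHom

/-- A morphism of props out of `Circ L` is determined by its values on cospans and edges. -/
theorem Circ.mor_ext {L : Type u} {Q : PROP.{v}} {F G : PROP.Mor (Circ L) Q}
    (h : (Circ.inclusion L).trans F = (Circ.inclusion L).trans G)
    (h' : ∀ l, F.map (Circ.edge l) = G.map (Circ.edge l)) : F = G := by
  have key : ∀ {m n : ℕ} (f : CircHom L m n), F.map (a := m) (b := n) f = G.map f := by
    refine CircHom.generation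
      (P := fun {m n} f => F.map (a := m) (b := n) f = G.map (a := m) (b := n) f) ?_ h' ?_ ?_
    · intro m n f
      exact congrArg (fun T : PROP.Mor FinCospan Q => T.map (a := m) (b := n) f) h
    · intro a b c f g hf hg
      exact (F.map_comp f g).trans ((congrArg₂ Q.comp hf hg).trans (G.map_comp f g).symm)
    · intro a b c d f g hf hg
      exact (F.map_tens f g).trans ((congrArg₂ Q.tens hf hg).trans (G.map_tens f g).symm)
  ext m n f
  exact key f

/-! ### The behavior of a circuit -/

section Behavior

variable {k : Type u} [Field k]

/-- By maximality the two subspaces coincide. This reduces the Lagrangian property of a behavior to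
isotropy and a single inclusion. -/
theorem IsLagrangian.of_le {V : Type v} [AddCommGroup V] [Module k V]
    {ω : LinearMap.BilinForm k V} {L M : Submodule k V} (hL : IsLagrangian ω L)
    (hM : IsIsotropic ω M) (h : L ≤ M) : IsLagrangian ω M := by
  rwa [hL.2 M hM h]

namespace LCircuit

/-- Potentials `ψ` on the nodes and currents `J` along the edges of a circuit realize the boundary
values `(x, y)` if `x` and `y` have the prescribed potentials, Ohm's law holds on every edge, and
Kirchhoff's current law, here in its weak form, holds at every node. -/
structure Realizes {m n : ℕ} (f : LCircuit k m n) (ψ : f.N → k) (J : f.E → k) (x : Phase k m)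
    (y : Phase k n) : Prop where
  input : ∀ i, (x i).1 = ψ (f.i i)
  output : ∀ j, (y j).1 = ψ (f.o j)
  ohm : ∀ e, ψ (f.t e) - ψ (f.s e) = f.ℓ e * J e
  -- For `χ` the indicator of a node this is the balance of currents at that node. Allowing every
  -- `χ` makes it possible to test against the potentials of another solution. Since `f.E` is
  -- finite, the `finsum` is an ordinary sum.
  kirchhoff : ∀ χ : f.N → k, ∑ i, χ (f.i i) * (x i).2 + ∑ᶠ e, (χ (f.t e) - χ (f.s e)) * J e
    = ∑ j, χ (f.o j) * (y j).2

/-- The linear relation imposed by a circuit between the potentials and currents at its inputs and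
those at its outputs. -/
def behavior {m n : ℕ} (f : LCircuit k m n) : LinRel k m n where
  carrier := {p | ∃ ψ J, f.Realizes ψ J p.1 p.2}
  zero_mem' := ⟨0, 0, fun _ => rfl, fun _ => rfl, fun _ => by simp, fun χ => by simp⟩
  add_mem' := by
    rintro p q ⟨ψ, J, h₁, h₂, h₃, h₄⟩ ⟨ψ', J', l₁, l₂, l₃, l₄⟩
    refine ⟨ψ + ψ', J + J', fun i => congrArg₂ (· + ·) (h₁ i) (l₁ i),
      fun j => congrArg₂ (· + ·) (h₂ j) (l₂ j), fun e => ?_, fun χ => ?_⟩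
    · simp only [Pi.add_apply]
      linear_combination h₃ e + l₃ e
    · have := Fintype.ofFinite f.E
      have e := h₄ χ
      have e' := l₄ χ
      simp only [finsum_eq_sum_of_fintype] at e e' ⊢
      simp only [Prod.fst_add, Prod.snd_add, Pi.add_apply, mul_add, Finset.sum_add_distrib]
      linear_combination e + e'
  smul_mem' := by
    rintro r p ⟨ψ, J, h₁, h₂, h₃, h₄⟩
    refine ⟨r • ψ, r • J, fun i => congrArg (r * ·) (h₁ i), fun j => congrArg (r * ·) (h₂ j),
      fun e => ?_, fun χ => ?_⟩
    · simp only [Pi.smul_apply, smul_eq_mul]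
      linear_combination r * h₃ e
    · have := Fintype.ofFinite f.E
      have e := h₄ χ
      simp only [finsum_eq_sum_of_fintype] at e ⊢
      simp only [Prod.smul_fst, Prod.smul_snd, Pi.smul_apply, smul_eq_mul, mul_left_comm _ r,
        ← Finset.mul_sum]
      linear_combination r * e

/-- Reciprocity: each solution's current law is tested against the other solution's potentials. By
Ohm's law the edges then contribute the sum of `ℓ J J'` in both identities, so the difference
involves the boundary alone, and it is the symplectic form. -/
theorem behavior_isIsotropic {m n : ℕ} (f : LCircuit k m n) :
    IsIsotropic (relSymp k m n) f.behavior := by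
  rintro ⟨x, y⟩ ⟨ψ, J, h₁, h₂, h₃, h₄⟩ ⟨x', y'⟩ ⟨ψ', J', l₁, l₂, l₃, l₄⟩
  have e := h₄ ψ'
  have e' := l₄ ψ
  simp only [h₃, l₃, ← h₁, ← h₂, ← l₁, ← l₂] at e e'
  have e'' : ∑ᶠ a, f.ℓ a * J a * J' a = ∑ᶠ a, f.ℓ a * J' a * J a :=
    finsum_congr fun a => by ring
  simp only [relSymp_apply, symp_apply, Finset.sum_sub_distrib]
  linear_combination e - e' + e''

theorem behavior_le_of_iso {m n : ℕ} {f g : LCircuit k m n} (h : f ≈ g) :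
    f.behavior ≤ g.behavior := by
  obtain ⟨e, e', h₁, h₂, h₃, h₄, h₅⟩ := h
  rintro ⟨x, y⟩ ⟨ψ, J, l₁, l₂, l₃, l₄⟩
  refine ⟨ψ ∘ e.symm, J ∘ e'.symm, fun i => ?_, fun j => ?_, fun a => ?_, fun χ => ?_⟩
  · simpa [← h₁] using l₁ i
  · simpa [← h₂] using l₂ j
  · obtain ⟨a, rfl⟩ := e'.surjective a
    simpa [← h₃, ← h₄, ← h₅] using l₃ a
  · rw [← finsum_comp_equiv e']
    simpa [h₁, h₂, h₃, h₄] using l₄ (χ ∘ e)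

theorem behavior_congr {m n : ℕ} {f g : LCircuit k m n} (h : f ≈ g) : f.behavior = g.behavior :=
  le_antisymm (behavior_le_of_iso h) (behavior_le_of_iso (Setoid.symm h))

/-- Solutions with the same values on the middle terminals glue: their potentials descend to the
pushout, and edge currents are taken side by side. The reverse inclusion, which would require
constructing currents through the glued terminals, follows later from maximality. -/
theorem comp_behavior_le {a b c : ℕ} (f : LCircuit k a b) (g : LCircuit k b c) :
    f.behavior.comp g.behavior ≤ (f.comp g).behavior := by
  rintro ⟨x, z⟩ ⟨y, ⟨ψ, J, h₁, h₂, h₃, h₄⟩, ⟨ψ', J', l₁, l₂, l₃, l₄⟩⟩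
  refine ⟨Pushout.desc ψ ψ' fun j => (h₂ j).symm.trans (l₁ j), Sum.elim J J', h₁, l₂, ?_,
    fun χ => ?_⟩
  · rintro (a | a)
    exacts [h₃ a, l₃ a]
  · have := Fintype.ofFinite f.E
    have := Fintype.ofFinite g.E
    let : Fintype (f.comp g).E := inferInstanceAs (Fintype (f.E ⊕ g.E))
    have e := h₄ fun p => χ (Pushout.inl _ _ p)
    have e' := l₄ fun p => χ (Pushout.inr _ _ p)
    -- The current leaving `f` at a middle terminal enters `g` at the same node of the pushout, so
    -- these terms cancel when the two current laws are added.
    have e'' : ∑ j, χ (Pushout.inl f.o g.i (f.o j)) * (y j).2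
        = ∑ j, χ (Pushout.inr f.o g.i (g.i j)) * (y j).2 :=
      Finset.sum_congr rfl fun j _ => by rw [Pushout.glue]
    rw [finsum_eq_sum_of_fintype] at e e' ⊢
    change _ + ∑ a : f.E ⊕ g.E, (χ ((f.comp g).t a) - χ ((f.comp g).s a)) * Sum.elim J J' a = _
    rw [Fintype.sum_sum_type]
    change ∑ i, χ (Pushout.inl _ _ (f.i i)) * (x i).2
      + (∑ a, (χ (Pushout.inl _ _ (f.t a)) - χ (Pushout.inl _ _ (f.s a))) * J a
        + ∑ a, (χ (Pushout.inr _ _ (g.t a)) - χ (Pushout.inr _ _ (g.s a))) * J' a)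
      = ∑ j, χ (Pushout.inr _ _ (g.o j)) * (z j).2
    linear_combination e + e' + e''

theorem tens_behavior_le {a b c d : ℕ} (f : LCircuit k a b) (g : LCircuit k c d) :
    f.behavior.tens g.behavior ≤ (f.tens g).behavior := by
  rintro ⟨x, y⟩ ⟨⟨ψ, J, h₁, h₂, h₃, h₄⟩, ⟨ψ', J', l₁, l₂, l₃, l₄⟩⟩
  refine ⟨Sum.elim ψ ψ', Sum.elim J J', fun i => ?_, fun j => ?_, ?_, fun χ => ?_⟩
  · refine Fin.addCases (fun i => ?_) (fun i => ?_) i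
    · simpa [tens, Cospan.tens] using h₁ i
    · simpa [tens, Cospan.tens] using l₁ i
  · refine Fin.addCases (fun i => ?_) (fun i => ?_) j
    · simpa [tens, Cospan.tens] using h₂ i
    · simpa [tens, Cospan.tens] using l₂ i
  · rintro (a | a)
    exacts [h₃ a, l₃ a]
  · have := Fintype.ofFinite f.E
    have := Fintype.ofFinite g.E
    let : Fintype (f.tens g).E := inferInstanceAs (Fintype (f.E ⊕ g.E))
    have e := h₄ fun p => χ (Sum.inl p)
    have e' := l₄ fun p => χ (Sum.inr p)
    rw [finsum_eq_sum_of_fintype] at e e' ⊢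
    change _ + ∑ a : f.E ⊕ g.E, (χ ((f.tens g).t a) - χ ((f.tens g).s a)) * Sum.elim J J' a = _
    rw [Fintype.sum_sum_type]
    rw [Fin.sum_univ_add, Fin.sum_univ_add]
    simp only [tens, Cospan.tens, split_castAdd, split_natAdd, Sum.map_inl, Sum.map_inr,
      Sum.elim_inl, Sum.elim_inr]
    linear_combination e + e'

/-- Without edges, a node outside the joint image of the legs is isolated and constrains nothing;
the laws on the remaining nodes are those on the blocks of the corelation. -/
theorem behavior_le_behavior_ofCospan {m n : ℕ} (f : Cospan m n) :
    f.toCorel.behavior k ≤ (ofCospan f : LCircuit k m n).behavior := by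
  rintro ⟨x, y⟩ h
  obtain ⟨⟨ψ, hx, hy⟩, hχ⟩ := Corel.behavior_spec h
  -- Nodes outside the joint image get potential `0`; any other value would do.
  have hinv : ∀ q, Function.extend (Corel.incl f) ψ 0 (Corel.incl f q) = ψ q :=
    fun q => (Corel.incl_injective f).extend_apply _ _ _
  refine ⟨Function.extend (Corel.incl f) ψ 0, Empty.elim, fun i => (hx i).trans (hinv _).symm,
    fun j => (hy j).trans (hinv _).symm, fun e => e.elim, fun χ => ?_⟩
  have : IsEmpty (ofCospan f : LCircuit k m n).E := inferInstanceAs (IsEmpty Empty)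
  rw [finsum_of_isEmpty, add_zero]
  exact hχ fun q => χ (Corel.incl f q)

theorem mem_behavior_edge {Z : k} {x y : Phase k 1} : (x, y) ∈ (edge Z).behavior ↔
    (y 0).1 - (x 0).1 = Z * (x 0).2 ∧ (x 0).2 = (y 0).2 := by
  let : Fintype (edge Z).E := inferInstanceAs (Fintype Unit)
  have hs : ∀ F : (edge Z).E → k, ∑ᶠ e, F e = F () := fun F =>
    (finsum_eq_sum_of_fintype F).trans (Fintype.sum_unique (ι := Unit) F)
  constructor
  · rintro ⟨ψ, J, h₁, h₂, h₃, h₄⟩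
    -- The indicators of the two nodes: the current law at the source gives `J = I₁`, and at the
    -- target `J = I₂`.
    have e₀ := h₄ ![1, 0]
    have e₁ := h₄ ![0, 1]
    have e := h₃ ()
    have p := h₁ 0
    have p' := h₂ 0
    simp only [hs] at e₀ e₁
    simp [edge] at e₀ e₁ e p p'
    rw [p, p', e]
    have hJ : J () = (x 0).2 := by linear_combination -e₀
    exact ⟨by rw [hJ], hJ.symm.trans e₁⟩
  · rintro ⟨h, h'⟩
    refine ⟨![(x 0).1, (y 0).1], fun _ => (x 0).2, fun i => ?_, fun j => ?_, fun _ => h,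
      fun χ => ?_⟩
    · rw [Subsingleton.elim i 0]; rfl
    · rw [Subsingleton.elim j 0]; rfl
    · rw [hs]
      simp [edge, ← h']
      ring

theorem edge_isLagrangian (Z : k) : IsLagrangian (relSymp k 1 1) (edge Z).behavior := by
  refine isLagrangian_of_orthogonal (behavior_isIsotropic _) ?_
  rintro ⟨x, y⟩ h
  -- Two elements of the behavior suffice as tests: constant potential without current, which forces
  -- `I₁ = I₂`, and unit current with potential difference `Z`, which gives `φ₂ - φ₁ = Z I₂`.
  have e := h (fun _ => (1, 0), fun _ => (1, 0)) (mem_behavior_edge.2 (by simp))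
  have e' := h (fun _ => (0, 1), fun _ => (Z, 1)) (mem_behavior_edge.2 (by simp))
  simp [relSymp_apply, symp_apply] at e e'
  refine mem_behavior_edge.2 ⟨?_, ?_⟩
  · linear_combination e' - Z * e
  · linear_combination e

end LCircuit

/-- The linear relation of a morphism of `Circ k`. -/
def CircHom.behavior {m n : ℕ} : CircHom k m n → LinRel k m n :=
  Quotient.lift LCircuit.behavior fun _ _ h => LCircuit.behavior_congr h

/-! ### Maximality: behaviors are Lagrangian -/

namespace CircHom

theorem behavior_isIsotropic {m n : ℕ} (f : CircHom k m n) :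
    IsIsotropic (relSymp k m n) f.behavior := by
  induction f using CircHom.ind with | _ f => exact f.behavior_isIsotropic

theorem comp_behavior_le {a b c : ℕ} (f : CircHom k a b) (g : CircHom k b c) :
    f.behavior.comp g.behavior ≤ (comp f g).behavior := by
  induction f using CircHom.ind with | _ f =>
  induction g using CircHom.ind with | _ g => exact f.comp_behavior_le g

theorem tens_behavior_le {a b c d : ℕ} (f : CircHom k a b) (g : CircHom k c d) :
    f.behavior.tens g.behavior ≤ (tens f g).behavior := by
  induction f using CircHom.ind with | _ f =>
  induction g using CircHom.ind with | _ g => exact f.tens_behavior_le g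

theorem behavior_le_behavior_ofCospanHom {m n : ℕ} (f : CospanHom m n) :
    (Corel.ofCospanHom f).behavior k ≤ (ofCospanHom f : CircHom k m n).behavior := by
  induction f using CospanHom.ind with | _ f =>
  exact LCircuit.behavior_le_behavior_ofCospan f

/-- Induction over the generators. In the cospan, composition and tensor cases the behavior is
isotropic and contains a relation already known to be Lagrangian, so it equals that relation. -/
theorem behavior_isLagrangian {m n : ℕ} (f : CircHom k m n) :
    IsLagrangian (relSymp k m n) f.behavior := by
  refine generation (P := fun {m n} f => IsLagrangian (relSymp k m n) f.behavior)
    (fun f => ?_) (fun Z => LCircuit.edge_isLagrangian Z) (fun f g hf hg => ?_)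
    (fun f g hf hg => ?_) f
  · exact (Corel.behavior_isLagrangian _).of_le (behavior_isIsotropic _)
      (behavior_le_behavior_ofCospanHom f)
  · exact (LinRel.comp_isLagrangian hf hg).of_le (behavior_isIsotropic _) (comp_behavior_le f g)
  · exact (LinRel.tens_isLagrangian hf hg).of_le (behavior_isIsotropic _) (tens_behavior_le f g)

/-- The Lagrangian relation of a morphism of `Circ k`. -/
def lagBehavior {m n : ℕ} (f : CircHom k m n) : LagRelHom k m n :=
  ⟨f.behavior, f.behavior_isLagrangian⟩

theorem lagBehavior_ofCospanHom {m n : ℕ} (f : CospanHom m n) :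
    lagBehavior (ofCospanHom f) = (K k).map (a := m) (b := n) (Corel.ofCospanHom f) :=
  (LagRelHom.eq_of_le (behavior_le_behavior_ofCospanHom f)).symm

end CircHom

/-! ### Existence and uniqueness of black-boxing -/

open CircHom in
/-- The black-boxing functor for linear circuits. -/
def blackBox (k : Type u) [Field k] : PROP.Mor (Circ k) (LagRel k) where
  map := lagBehavior
  map_id a := (lagBehavior_ofCospanHom (CospanHom.id a)).trans ((H.trans (K k)).map_id a)
  map_comp f g := (LagRelHom.eq_of_le (comp_behavior_le f g)).symm
  map_tens f g := (LagRelHom.eq_of_le (tens_behavior_le f g)).symm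
  map_braid a b := (lagBehavior_ofCospanHom (FinCospan.braid a b)).trans
    ((H.trans (K k)).map_braid a b)

theorem blackBox_isBlackBoxing : IsBlackBoxing (blackBox k) where
  restrict := by
    ext m n f
    exact CircHom.lagBehavior_ofCospanHom f
  impedance _ _ _ := LCircuit.mem_behavior_edge

theorem IsBlackBoxing.unique {B B' : PROP.Mor (Circ k) (LagRel k)} (hB : IsBlackBoxing B)
    (hB' : IsBlackBoxing B') : B = B' :=
  Circ.mor_ext (hB.restrict.trans hB'.restrict.symm) fun Z => Subtype.ext <| Submodule.ext
    fun p => (hB.impedance Z p.1 p.2).trans (hB'.impedance Z p.1 p.2).symm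

end Behavior

/-! ### Circuits of ideal wires -/

theorem Circ.inclusion_relabel {L : Type u} {L' : Type v} (p : L → L') :
    (Circ.inclusion L).trans (Circ.relabel p) = Circ.inclusion L' := by
  ext m n f
  revert f
  refine CospanHom.ind fun f => ?_
  exact CircHom.mk_eq (Equiv.refl _) (Equiv.refl _) (fun _ => rfl) (fun _ => rfl)
    (fun a => a.elim) (fun a => a.elim) (fun a => a.elim)

theorem Circ.collapse_inclusion {L : Type u} {m n : ℕ} (f : CospanHom m n) :
    (Circ.collapse L).map ((Circ.inclusion L).map (a := m) (b := n) f) = f := by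
  induction f using CospanHom.ind with | _ f =>
  exact Quotient.sound (LCircuit.components_ofCospan f)

/-- The edge joins its two end nodes, leaving one component that carries both the input and the
output. -/
theorem Circ.collapse_edge {L : Type u} (l : L) :
    (Circ.collapse L).map (Circ.edge l) = FinCospan.id 1 := by
  have hg := LCircuit.Components.glue (LCircuit.edge l) ()
  refine CospanHom.mk_eq (f := (LCircuit.edge l).components) (g := Cospan.ofFun id)
    ⟨fun _ => (0 : Fin 1), fun _ => Quot.mk _ (0 : Fin 2), ?_,
      fun _ => Subsingleton.elim (α := Fin 1) _ _⟩
    (fun _ => Subsingleton.elim (α := Fin 1) _ _) (fun _ => Subsingleton.elim (α := Fin 1) _ _)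
  rintro ⟨x⟩
  change Fin 2 at x
  fin_cases x
  exacts [rfl, hg]

/-- The two morphisms are compared on generators. Neither relabelling nor contraction affects a
circuit without edges, so both restrict to the composite of `H` and `K`. On an edge, Ohm's law with
`Z = 0` leaves `φ₁ = φ₂` and `I₁ = I₂`, the identity relation, which is also the image of the
contracted edge. -/
theorem IsBlackBoxing.relabel_zero {k : Type u} [Field k] {B : PROP.Mor (Circ k) (LagRel k)}
    (hB : IsBlackBoxing B) :
    (Circ.relabel (fun _ : Unit => (0 : k))).trans B = idealBlackBox k := by
  refine Circ.mor_ext ?_ fun l => ?_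
  · refine (congrArg (fun F => PROP.Mor.trans F B) (Circ.inclusion_relabel _)).trans
      (hB.restrict.trans ?_)
    ext m n f
    exact congrArg (H.trans (K k)).map (Circ.collapse_inclusion f).symm
  · refine Eq.trans ?_ ((congrArg (H.trans (K k)).map (Circ.collapse_edge l)).trans
      ((H.trans (K k)).map_id 1)).symm
    refine Subtype.ext (Submodule.ext fun p => (hB.impedance 0 p.1 p.2).trans ?_)
    change _ ↔ ∀ i, p.1 i = p.2 i
    rw [Fin.forall_fin_one, Prod.ext_iff, zero_mul, sub_eq_zero, eq_comm]

end BlackBoxing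

theorem mainTheorem4 (k : Type u) [Field k] :
    (∃! B : BlackBoxing.PROP.Mor (BlackBoxing.Circ k) (BlackBoxing.LagRel k),
      BlackBoxing.IsBlackBoxing B) ∧
    ∀ B : BlackBoxing.PROP.Mor (BlackBoxing.Circ k) (BlackBoxing.LagRel k),
      BlackBoxing.IsBlackBoxing B →
        (BlackBoxing.Circ.relabel (fun _ : Unit => (0 : k))).trans B
          = BlackBoxing.idealBlackBox k := by
  exact ⟨⟨BlackBoxing.blackBox k, BlackBoxing.blackBox_isBlackBoxing,
    fun _ hB => hB.unique BlackBoxing.blackBox_isBlackBoxing⟩, fun _ hB => hB.relabel_zero⟩
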